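/- **Setting.** Let $\mathsf N\in\mathbb N$, $2s_1,\dots,2s_{\mathsf N}\in\mathbb N=\{0,1,2,\dots\}$, $\xi_1,\dots,\xi_{\mathsf N}\in\mathbb C$, and let $\eta\in\mathbb C$ be such that $q=e^\eta$ is not a root of unity. Write $[j]_q=\sinh(\eta j)/\sinh\eta$. For each $n$ let $V_n=\mathbb C^{2s_n+1}$ have basis $|k,n\rangle$, $0\le k\le 2s_n$, with dual basis $\langle k,n|$, and let $$S_n^z|k,n\rangle=(s_n-k)|k,n\rangle,\quad S_n^-|k,n\rangle=x_n(k+1)|k+1,n\rangle,\quad S_n^+|k,n\rangle=x_n(k)|k-1,n\rangle,$$ where $x_n(k)=\sqrt{[k]_q[2s_n-k+1]_q}$ (any fixed choice of the square roots; $x_n(0)=x_n(2s_n+1)=0$). On $\mathcal H=\bigotimes_n V_n$ define operators $A(\lambda),B(\lambda),C(\lambda),D(\lambda)$, $\lambda\in\mathbb C$, by $$\begin{pmatrix}A(\lambda)&B(\lambda)\\ C(\lambda)&D(\lambda)\end{pmatrix}=L_{\mathsf N}(\lambda-\xi_{\mathsf N})\cdots L_1(\lambda-\xi_1),\qquad L_n(\lambda)=\begin{pmatrix}\sinh(\lambda+\eta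 S_n^z)&S_n^-\sinh\eta\\ S_n^+\sinh\eta&\sinh(\lambda-\eta S_n^z)\end{pmatrix}.$$ Put $\xi_n^{(k)}=\xi_n+(s_n-k)\eta$, $a(\lambda)=\prod_n\sinh(\lambda-\xi_n+s_n\eta)$, $d(\lambda)=\prod_n\sinh(\lambda-\xi_n-s_n\eta)$, and let $\nu$ be a square root of $\prod_{i<j}\sinh(\xi_j^{(0)}-\xi_i^{(0)})$. Put $\langle\mathbf 0|=\nu^{-1}\bigotimes_n\langle 0,n|$, $|\mathbf 0\rangle=\nu^{-1}\bigotimes_n|0,n\rangle$ and, for $\mathbf h=(h_1,\dots,h_{\mathsf N})$ with $h_n\in\{0,\dots,2s_n\}$, $$\langle\mathbf h|=\langle\mathbf 0|\prod_{n=1}^{\mathsf N}\prod_{k=0}^{h_n-1}\frac{C(\xi_n^{(k)})}{d(\xi_n^{(k+1)})},\qquad |\mathbf h\rangle=\prod_{n=1}^{\mathsf N}\prod_{k=0}^{h_n-1}\left(-\frac{B(\xi_n^{(k)})}{a(\xi_n^{(k)})}\right)|\mathbf 0\rangle .$$ Finally put $d_{\mathbf h}(\lambda)=\prod_n\sinh(\lambda-\xi_n^{(h_n)})$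 and $\mathrm T_a^\pm\mathbf h=(h_1,\dots,h_a\pm1,\dots,h_{\mathsf N})$. **Theorem 3.1.** Assume that $\Xi_i\cap\Xi_j=\emptyset$ for all $i\ne j$, where $\Xi_i=\{\xi_i+k\eta+k'i\pi : k\in\{-s_i,-s_i+1,\dots,s_i\},\ k'\in\mathbb Z\}$ (in $k'i\pi$, $i$ is the imaginary unit). Then the operators $B(\lambda)$, $\lambda\in\mathbb C$, commute with each other, as do the $C(\lambda)$ (so the products above do not depend on the order of the factors). The family $D(\lambda)$, $\lambda\in\mathbb C$, is diagonalizable with simple spectrum: its joint eigenspaces $\{v : D(\lambda)v=t(\lambda)v\ \ \forall\lambda\}$, over all functions $t:\mathbb C\to\mathbb C$, span $\mathcal H$ and each has dimension at most one. Moreover, for all $\lambda\in\mathbb C$ and all $\mathbf h,\mathbf k$: I) The covectors $\langle\mathbf h|$ form a basis of the dual space of $\mathcal H$, and $$\langle\mathbf h|D(\lambda)=d_{\mathbf h}(\lambda)\langle\mathbf h|,$$ $$\langle\mathbf h|C(\lambda)=\sum_{a=1}^{\mathsf N}\prod_{b\ne a}\frac{\sinh(\lambda-\xi_b^{(h_b)})}{\sinh(\xi_a^{(h_a)}-\xi_b^{(h_b)})}\,(1-\delta_{h_a,2s_a})\,d(\xi_a^{(h_a+1)})\,\langle\mathrm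 T_a^+\mathbf h|,$$ $$\langle\mathbf h|B(\lambda)=-\sum_{a=1}^{\mathsf N}\prod_{b\ne a}\frac{\sinh(\lambda-\xi_b^{(h_b)})}{\sinh(\xi_a^{(h_a)}-\xi_b^{(h_b)})}\,(1-\delta_{h_a,0})\,a(\xi_a^{(h_a-1)})\,\langle\mathrm T_a^-\mathbf h|.$$ II) The vectors $|\mathbf h\rangle$ form a basis of $\mathcal H$, and $$D(\lambda)|\mathbf h\rangle=d_{\mathbf h}(\lambda)|\mathbf h\rangle,$$ $$C(\lambda)|\mathbf h\rangle=\sum_{a=1}^{\mathsf N}\prod_{b\ne a}\frac{\sinh(\lambda-\xi_b^{(h_b)})}{\sinh(\xi_a^{(h_a)}-\xi_b^{(h_b)})}\,d(\xi_a^{(h_a)})\,|\mathrm T_a^-\mathbf h\rangle,$$ $$B(\lambda)|\mathbf h\rangle=-\sum_{a=1}^{\mathsf N}\prod_{b\ne a}\frac{\sinh(\lambda-\xi_b^{(h_b)})}{\sinh(\xi_a^{(h_a)}-\xi_b^{(h_b)})}\,a(\xi_a^{(h_a)})\,|\mathrm T_a^+\mathbf h\rangle.$$ (In these sums, the terms in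 which $\mathrm T_a^\pm\mathbf h$ is out of range have coefficient $0$.) III) The operators $A(\lambda)$ satisfy, for all $\lambda\in\mathbb C$, the quantum determinant relations $$A(\lambda)D(\lambda-\eta)-B(\lambda)C(\lambda-\eta)=a(\lambda)d(\lambda-\eta)=D(\lambda)A(\lambda-\eta)-C(\lambda)B(\lambda-\eta),$$ and they are uniquely determined by either of the two: any continuous operator-valued function $A'$ of $\lambda$ that satisfies, for all $\lambda$, the first relation or, for all $\lambda$, the second relation (with $A'$ in place of $A$) is equal to $A$. IV) $\displaystyle\langle\mathbf h|\mathbf k\rangle=\prod_{j=1}^{\mathsf N}\delta_{h_j,k_j}\prod_{1\le i<j\le\mathsf N}\frac1{\sinh(\xi_j^{(h_j)}-\xi_i^{(h_i)})}$, and consequently $$\mathbb I=\sum_{\mathbf h}\ \prod_{1\le i<j\le\mathsf N}\sinh(\xi_j^{(h_j)}-\xi_i^{(h_i)})\ |\mathbf h\rangle\langle\mathbf h| ,$$ where the sum runs over all $\mathbf h$ with $h_i\in\{0,\dots,2s_i\}$. -/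

import Mathlib

/-- The parameters of an inhomogeneous XXZ chain with `N` sites: the anisotropy `η`, the doubled
spins `twoS n = 2 sₙ ∈ ℕ` and the inhomogeneities `ξ n`, together with the square roots that enter
the normalisations: `x n k` stands for `√([k]_q [2sₙ - k + 1]_q)` and `ν` for the normalisation of
the reference states. Which numbers `x n k` and `ν` are square roots of is recorded in the predicates
`XXZChain.RootsLadder` and `XXZChain.RootNorm`, so that all branches are allowed. -/
structure XXZChain (N : ℕ) where
  η : ℂ
  twoS : Fin N → ℕ
  ξ : Fin N → ℂ
  x : Fin N → ℕ → ℂ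
  ν : ℂ

namespace XXZChain

variable {N : ℕ} (c : XXZChain N)

/-- The spin `sₙ`. -/
noncomputable def s (n : Fin N) : ℂ := (c.twoS n : ℂ) / 2

/-- The `q`-integer `[j]_q = sinh (η j) / sinh η`, where `q = exp η`. -/
noncomputable def qInt (j : ℕ) : ℂ := Complex.sinh (c.η * j) / Complex.sinh c.η

/-- `q = exp η` is not a root of unity, i.e. `η` is not commensurate to `iπ`. -/
def Generic : Prop := ∀ m : ℕ, 0 < m → Complex.exp c.η ^ m ≠ 1

/-- `x n k` is a square root of `[k]_q [2sₙ - k + 1]_q`, for `1 ≤ k ≤ 2sₙ`. -/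
def RootsLadder : Prop :=
  ∀ (n : Fin N) (k : ℕ), 1 ≤ k → k ≤ c.twoS n →
    c.x n k ^ 2 = c.qInt k * c.qInt (c.twoS n + 1 - k)

/-- The index set of the basis of the space of states: `N`-tuples `h` with `hₙ ∈ {0, …, 2sₙ}`. -/
abbrev Config : Type := ∀ n : Fin N, Fin (c.twoS n + 1)

/-- Operators on the space of states `⨂ₙ ℂ^(2sₙ+1)`, written in the tensor product basis
`|h₁,1⟩ ⊗ ⋯ ⊗ |h_N,N⟩`, `h : c.Config`. They act on vectors (right states) by `Matrix.mulVec` and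
on covectors (left states) by `Matrix.vecMul`. -/
abbrev Op : Type := Matrix c.Config c.Config ℂ

/-- The vectors (or covectors), by their coordinates in the tensor product basis (or dual basis). -/
abbrev State : Type := c.Config → ℂ

/-- The operator acting as `M` on the site `n` and as the identity on the other sites. -/
def siteOp (n : Fin N) (M : Matrix (Fin (c.twoS n + 1)) (Fin (c.twoS n + 1)) ℂ) : c.Op :=
  Matrix.of fun h k => if ∀ m, m ≠ n → h m = k m then M (h n) (k n) else 0

/-- The local operator `sinh (u + η Sᶻ)`; here `Sᶻ |k,n⟩ = (sₙ - k) |k,n⟩`. -/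
noncomputable def sinhSz (n : Fin N) (u η : ℂ) :
    Matrix (Fin (c.twoS n + 1)) (Fin (c.twoS n + 1)) ℂ :=
  Matrix.diagonal fun k => Complex.sinh (u + η * (c.s n - ((k : ℕ) : ℂ)))

/-- The local operator `S⁻`, `S⁻ |k,n⟩ = x n (k+1) |k+1,n⟩` and `⟨k,n| S⁻ = x n k ⟨k-1,n|`. -/
def Sminus (n : Fin N) : Matrix (Fin (c.twoS n + 1)) (Fin (c.twoS n + 1)) ℂ :=
  Matrix.of fun i j => if (i : ℕ) = j + 1 then c.x n i else 0

/-- The local operator `S⁺`, `S⁺ |k,n⟩ = x n k |k-1,n⟩` and `⟨k,n| S⁺ = x n (k+1) ⟨k+1,n|`. -/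
def Splus (n : Fin N) : Matrix (Fin (c.twoS n + 1)) (Fin (c.twoS n + 1)) ℂ :=
  Matrix.of fun i j => if (j : ℕ) = i + 1 then c.x n j else 0

/-- The quantum Lax operator at site `n`, as a `2 × 2` matrix (in the auxiliary space) of operators
on the space of states. -/
noncomputable def Lax (n : Fin N) (u : ℂ) : Matrix (Fin 2) (Fin 2) c.Op :=
  !![c.siteOp n (c.sinhSz n u c.η), c.siteOp n (Complex.sinh c.η • c.Sminus n);
     c.siteOp n (Complex.sinh c.η • c.Splus n), c.siteOp n (c.sinhSz n u (-c.η))]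

/-- The monodromy matrix `L_N(u - ξ_N) ⋯ L_1(u - ξ_1)`. -/
noncomputable def monodromy (u : ℂ) : Matrix (Fin 2) (Fin 2) c.Op :=
  (List.ofFn fun n : Fin N => c.Lax n (u - c.ξ n)).reverse.prod

/-- The entry `(1,1)` of the monodromy matrix. -/
noncomputable def A (u : ℂ) : c.Op := c.monodromy u 0 0

/-- The entry `(1,2)` of the monodromy matrix. -/
noncomputable def B (u : ℂ) : c.Op := c.monodromy u 0 1

/-- The entry `(2,1)` of the monodromy matrix. -/
noncomputable def C (u : ℂ) : c.Op := c.monodromy u 1 0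

/-- The entry `(2,2)` of the monodromy matrix. -/
noncomputable def D (u : ℂ) : c.Op := c.monodromy u 1 1

/-- `a(u) = ∏ₙ sinh (u - ξₙ + sₙ η)`. -/
noncomputable def a (u : ℂ) : ℂ := ∏ n, Complex.sinh (u - c.ξ n + c.s n * c.η)

/-- `d(u) = ∏ₙ sinh (u - ξₙ - sₙ η)`. -/
noncomputable def d (u : ℂ) : ℂ := ∏ n, Complex.sinh (u - c.ξ n - c.s n * c.η)

/-- The shifted inhomogeneities `ξₙ^(k) = ξₙ + (sₙ - k) η`. -/
noncomputable def xi (n : Fin N) (k : ℕ) : ℂ := c.ξ n + (c.s n - (k : ℂ)) * c.η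

/-- The set `Ξₙ` of all `ξₙ + k η + m π i`, with `k ∈ {-sₙ, -sₙ + 1, …, sₙ}` and `m ∈ ℤ`. -/
def Xi (n : Fin N) : Set ℂ :=
  {z | ∃ j : ℕ, j ≤ c.twoS n ∧ ∃ m : ℤ,
    z = c.ξ n + (-c.s n + (j : ℂ)) * c.η + (m : ℂ) * (Real.pi * Complex.I)}

/-- The inhomogeneity condition: the sets `Ξₙ` are pairwise disjoint. -/
def Inhomogeneous : Prop := ∀ i j : Fin N, i ≠ j → c.Xi i ∩ c.Xi j = ∅

/-- `∏_{i<j} sinh (ξ_j^(h_j) - ξ_i^(h_i))`. -/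
noncomputable def vdm (h : Fin N → ℕ) : ℂ :=
  ∏ i, ∏ j ∈ Finset.Ioi i, Complex.sinh (c.xi j (h j) - c.xi i (h i))

/-- `ν` is a square root of `∏_{i<j} sinh (ξ_j^(0) - ξ_i^(0))`. -/
def RootNorm : Prop := c.ν ^ 2 = c.vdm 0

/-- The reference state `(1/ν) ⨂ₙ |0,n⟩`, also used for the reference covector
`(1/ν) ⨂ₙ ⟨0,n|`, which has the same coordinates. -/
noncomputable def ref : c.State := c.ν⁻¹ • Pi.single (fun _ => 0) 1

/-- The left state `⟨h| = ⟨0| ∏ₙ ∏_{k<hₙ} C(ξₙ^(k)) / d(ξₙ^(k+1))`, with the factors written from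
left to right in increasing order of `n` and then of `k`. (It is defined for all `h`, but only used
for `hₙ ≤ 2sₙ`, or with the coefficient `0`.) -/
noncomputable def bra (h : Fin N → ℕ) : c.State :=
  Matrix.vecMul c.ref
    ((List.finRange N).map fun n =>
      ((List.range (h n)).map fun k => (c.d (c.xi n (k + 1)))⁻¹ • c.C (c.xi n k)).prod).prod

/-- The right state `|h⟩ = ∏ₙ ∏_{k<hₙ} (-B(ξₙ^(k)) / a(ξₙ^(k))) |0⟩`, with the same conventions. -/
noncomputable def ket (h : Fin N → ℕ) : c.State :=
  Matrix.mulVec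
    ((List.finRange N).map fun n =>
      ((List.range (h n)).map fun k => -((c.a (c.xi n k))⁻¹ • c.B (c.xi n k))).prod).prod
    c.ref

/-- The `N`-tuple of natural numbers underlying a configuration. -/
def Config.toNat {c : XXZChain N} (h : c.Config) : Fin N → ℕ := fun n => (h n : ℕ)

/-- `d_h(u) = ∏ₙ sinh (u - ξₙ^(hₙ))`. -/
noncomputable def eig (h : Fin N → ℕ) (u : ℂ) : ℂ := ∏ n, Complex.sinh (u - c.xi n (h n))

/-- The coefficient `∏_{b ≠ a} sinh (u - ξ_b^(h_b)) / sinh (ξ_a^(h_a) - ξ_b^(h_b))`. -/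
noncomputable def interp (h : Fin N → ℕ) (a : Fin N) (u : ℂ) : ℂ :=
  ∏ b ∈ Finset.univ.erase a,
    Complex.sinh (u - c.xi b (h b)) / Complex.sinh (c.xi a (h a) - c.xi b (h b))

end XXZChain

/-- `T_a^+ h`: the `a`-th entry is raised by one. -/
def shiftUp {N : ℕ} (a : Fin N) (h : Fin N → ℕ) : Fin N → ℕ := Function.update h a (h a + 1)

/-- `T_a^- h`: the `a`-th entry is lowered by one. (Where `h a = 0`, this only ever occurs with
coefficient `0`.) -/
def shiftDown {N : ℕ} (a : Fin N) (h : Fin N → ℕ) : Fin N → ℕ := Function.update h a (h a - 1)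

/-- The joint eigenspace of a one-parameter family of operators for an eigenvalue function `t`. -/
def jointEigenspace {ι : Type} [Fintype ι] (F : ℂ → Matrix ι ι ℂ) (t : ℂ → ℂ) :
    Submodule ℂ (ι → ℂ) :=
  ⨅ u : ℂ, Module.End.eigenspace (F u).mulVecLin (t u)

/-- A one-parameter family of operators `F(u)` is diagonalizable with simple spectrum: its joint
eigenspaces span the space (so that the `F(u)` can be diagonalized in a common basis), and the joint
eigenspace of each eigenvalue function is at most one-dimensional. -/
def DiagonalizableSimple {ι : Type} [Fintype ι] (F : ℂ → Matrix ι ι ℂ) : Prop :=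
  (⨆ t : ℂ → ℂ, jointEigenspace F t) = ⊤ ∧
    ∀ t : ℂ → ℂ, Module.finrank ℂ (jointEigenspace F t) ≤ 1

/-- The family `v` is a basis of its ambient space. -/
def IsBasisFamily {ι E : Type} [AddCommGroup E] [Module ℂ E] (v : ι → E) : Prop :=
  LinearIndependent ℂ v ∧ Submodule.span ℂ (Set.range v) = ⊤

/-! The proof is separation of variables in an eigenbasis of `D`. It rests on two quadratic
identities for the monodromy matrix: the six-vertex exchange relation and the quantum determinant
relation. Both are verified for one Lax operator (`exchange_localLax`, `qDet_localLax`) and pass to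
products because entries at different sites commute (`Exchange.mul`, `QDet.mul`).

The reference states are eigenstates of all D(u), with eigenvalue d(u). If w is a left eigenstate
with eigenvalue `c.eig h`, then D(v) kills w at v = ξ_a^(h_a). The unwanted term of the exchange
relation disappears, and w C(v) is zero or an eigenstate with the zero v of the eigenvalue moved to
v - η (`vecMul_C_vecMul_D`; `D_mulVec_B_mulVec` for kets). Thus bras and kets are eigenstates for
`c.eig h`, and generic η with the inhomogeneity condition makes these functions distinct for
admissible h.

The entries of B and C are trigonometric polynomials with N frequencies, so their values at the N
points ξ_a^(h_a) determine them (`IsTrigPoly.eq_interpolation`). At these points the quantum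
determinant shows that C lowers kets and B lowers bras (`C_xi_mulVec_ket`, `bra_vecMul_B_xi`).

Distinct eigenvalues make bras and kets orthogonal, and lowering gives a recursion for the diagonal
pairings, solved by the inverse Vandermonde product (`bra_dotProduct_ket_self_mul_vdm`). These
pairings are nonzero, so both families are bases. Only then does raising beyond 2s_a give zero: the
result would be an eigenstate for a function outside the spectrum. Finally, D(u) acts on the bases
by products of sinh whose zero sets have empty interior, so a continuous A is determined by either
determinant relation. -/

namespace YangBaxter

open Matrix

/-! ### Two auxiliary spaces: exchange relation and quantum determinant -/

section Auxiliary

variable {R : Type*} [Ring R]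

/-- The `2 × 2` matrix `X` acting on the first of two auxiliary spaces. -/
def aux₁ (X : Matrix (Fin 2) (Fin 2) R) : Matrix (Fin 2 × Fin 2) (Fin 2 × Fin 2) R :=
  Matrix.of fun p q => if p.2 = q.2 then X p.1 q.1 else 0

/-- The `2 × 2` matrix `X` acting on the second of two auxiliary spaces. -/
def aux₂ (X : Matrix (Fin 2) (Fin 2) R) : Matrix (Fin 2 × Fin 2) (Fin 2 × Fin 2) R :=
  Matrix.of fun p q => if p.1 = q.1 then X p.2 q.2 else 0

/-- All entries of `X` commute with all entries of `Y`. -/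
def EntriesCommute (X Y : Matrix (Fin 2) (Fin 2) R) : Prop :=
  ∀ i j k l, Commute (X i j) (Y k l)

theorem EntriesCommute.symm {X Y : Matrix (Fin 2) (Fin 2) R} (h : EntriesCommute X Y) :
    EntriesCommute Y X := fun i j k l => (h k l i j).symm

theorem EntriesCommute.mul_right {X Y Z : Matrix (Fin 2) (Fin 2) R} (h : EntriesCommute X Y)
    (h' : EntriesCommute X Z) : EntriesCommute X (Y * Z) := by
  intro i j k l
  rw [Matrix.mul_apply]
  exact Commute.sum_right _ _ _ fun m _ => (h _ _ _ _).mul_right (h' _ _ _ _)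

theorem aux₁_mul (X Y : Matrix (Fin 2) (Fin 2) R) : aux₁ (X * Y) = aux₁ X * aux₁ Y := by
  ext ⟨i, i'⟩ ⟨j, j'⟩
  simp only [aux₁, Matrix.of_apply, Matrix.mul_apply, Fintype.sum_prod_type, ite_mul, mul_ite,
    zero_mul, mul_zero, Finset.sum_ite_eq', Finset.mem_univ, if_true]
  split_ifs <;> simp

theorem aux₂_mul (X Y : Matrix (Fin 2) (Fin 2) R) : aux₂ (X * Y) = aux₂ X * aux₂ Y := by
  ext ⟨i, i'⟩ ⟨j, j'⟩
  simp only [aux₂, Matrix.of_apply, Matrix.mul_apply, Fintype.sum_prod_type_right, ite_mul,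
    mul_ite, zero_mul, mul_zero, Finset.sum_ite_eq', Finset.mem_univ, if_true]
  split_ifs <;> simp

theorem aux₁_mul_aux₂_apply (X Y : Matrix (Fin 2) (Fin 2) R) (p q : Fin 2 × Fin 2) :
    (aux₁ X * aux₂ Y) p q = X p.1 q.1 * Y p.2 q.2 := by
  simp [aux₁, aux₂, Matrix.mul_apply, Fintype.sum_prod_type]

theorem aux₂_mul_aux₁_apply (X Y : Matrix (Fin 2) (Fin 2) R) (p q : Fin 2 × Fin 2) :
    (aux₂ Y * aux₁ X) p q = Y p.2 q.2 * X p.1 q.1 := by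
  simp [aux₁, aux₂, Matrix.mul_apply, Fintype.sum_prod_type]

theorem EntriesCommute.aux_comm {X Y : Matrix (Fin 2) (Fin 2) R} (h : EntriesCommute X Y) :
    aux₁ X * aux₂ Y = aux₂ Y * aux₁ X := by
  ext p q
  rw [aux₁_mul_aux₂_apply, aux₂_mul_aux₁_apply, (h _ _ _ _).eq]

end Auxiliary

section Intertwiner

variable {R : Type*} [Ring R] [Algebra ℂ R]

/-- The six-vertex matrix with weights `a`, `b`, `c`. -/
def sixVertex (R : Type*) [Ring R] [Algebra ℂ R] (a b c : ℂ) :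
    Matrix (Fin 2 × Fin 2) (Fin 2 × Fin 2) R :=
  Matrix.of fun p q =>
    algebraMap ℂ R (if p = q then (if p.1 = p.2 then a else b) else if p = q.swap then c else 0)

/-- The Yang-Baxter exchange relation `R X₁ Y₂ = Y₂ X₁ R` for the six-vertex matrix `R`. -/
def Exchange (a b c : ℂ) (X Y : Matrix (Fin 2) (Fin 2) R) : Prop :=
  sixVertex R a b c * (aux₁ X * aux₂ Y) = aux₂ Y * aux₁ X * sixVertex R a b c

/-- The train argument: X' slides past Y, and X past Y', so that the six-vertex matrix passes one
pair of factors at a time. -/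
theorem Exchange.mul {a b c : ℂ} {X Y X' Y' : Matrix (Fin 2) (Fin 2) R}
    (h : Exchange a b c X Y) (h' : Exchange a b c X' Y') (hXY : EntriesCommute X Y')
    (hYX : EntriesCommute X' Y) : Exchange a b c (X * X') (Y * Y') := by
  unfold Exchange at *
  rw [aux₁_mul, aux₂_mul]
  calc sixVertex R a b c * (aux₁ X * aux₁ X' * (aux₂ Y * aux₂ Y'))
      = sixVertex R a b c * (aux₁ X * (aux₁ X' * aux₂ Y) * aux₂ Y') := by
        simp only [mul_assoc]
    _ = sixVertex R a b c * (aux₁ X * aux₂ Y) * (aux₁ X' * aux₂ Y') := by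
        rw [hYX.aux_comm]; simp only [mul_assoc]
    _ = aux₂ Y * aux₁ X * (sixVertex R a b c * (aux₁ X' * aux₂ Y')) := by
        rw [h]; simp only [mul_assoc]
    _ = aux₂ Y * (aux₁ X * aux₂ Y') * aux₁ X' * sixVertex R a b c := by
        rw [h']; simp only [mul_assoc]
    _ = _ := by rw [hXY.aux_comm]; simp only [mul_assoc]

theorem Exchange.one (a b c : ℂ) : Exchange a b c (1 : Matrix (Fin 2) (Fin 2) R) 1 := by
  have h1 : aux₁ (1 : Matrix (Fin 2) (Fin 2) R) = 1 := by
    ext ⟨i, i'⟩ ⟨j, j'⟩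
    simp [aux₁, Matrix.one_apply, Prod.ext_iff]
    grind
  have h2 : aux₂ (1 : Matrix (Fin 2) (Fin 2) R) = 1 := by
    ext ⟨i, i'⟩ ⟨j, j'⟩
    simp [aux₂, Matrix.one_apply, Prod.ext_iff]
    grind
  simp [Exchange, h1, h2]

/-- The six-vertex matrix mixes only (i, i') with (i', i), so each component has at most two terms
on either side. All commutation relations between A, B, C, D used below are among these components.
-/
theorem exchange_iff {a b c : ℂ} {X Y : Matrix (Fin 2) (Fin 2) R} :
    Exchange a b c X Y ↔ ∀ i i' k k' : Fin 2,
      (if i = i' then a • (X i k * Y i' k') else b • (X i k * Y i' k') + c • (X i' k * Y i k')) =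
      (if k = k' then a • (Y i' k' * X i k) else b • (Y i' k' * X i k) + c • (Y i' k * X i k')) := by
  unfold Exchange
  rw [← Matrix.ext_iff]
  simp only [Prod.forall]
  refine forall₄_congr fun i i' k k' => ?_
  have hl : (sixVertex R a b c * (aux₁ X * aux₂ Y)) (i, i') (k, k') =
      (if i = i' then a • (X i k * Y i' k')
        else b • (X i k * Y i' k') + c • (X i' k * Y i k')) := by
    rw [Matrix.mul_apply]
    simp only [aux₁_mul_aux₂_apply, Fintype.sum_prod_type, Fin.sum_univ_two, sixVertex,
      Matrix.of_apply, ← Algebra.smul_def]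
    fin_cases i <;> fin_cases i' <;> simp [add_comm]
  have hr : (aux₂ Y * aux₁ X * sixVertex R a b c) (i, i') (k, k') =
      (if k = k' then a • (Y i' k' * X i k)
        else b • (Y i' k' * X i k) + c • (Y i' k * X i k')) := by
    rw [Matrix.mul_apply]
    simp only [aux₂_mul_aux₁_apply, Fintype.sum_prod_type, Fin.sum_univ_two, sixVertex,
      Matrix.of_apply, ← Algebra.commutes, ← Algebra.smul_def]
    fin_cases k <;> fin_cases k' <;> simp [add_comm]
  rw [hl, hr]

theorem Exchange.map {S : Type*} [Ring S] [Algebra ℂ S] (f : R →ₐ[ℂ] S) {a b c : ℂ}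
    {X Y : Matrix (Fin 2) (Fin 2) R} (h : Exchange a b c X Y) :
    Exchange a b c (X.map f) (Y.map f) := by
  rw [exchange_iff] at h ⊢
  intro i i' k k'
  have := congrArg f (h i i' k k')
  simp only [apply_ite f, map_add, map_smul, map_mul] at this
  simpa only [Matrix.map_apply] using this

end Intertwiner

section QuantumDeterminant

variable {R : Type*} [Ring R]

/-- The adjugate of a `2 × 2` matrix with noncommuting entries. -/
def adj (X : Matrix (Fin 2) (Fin 2) R) : Matrix (Fin 2) (Fin 2) R :=
  !![X 1 1, -X 0 1; -X 1 0, X 0 0]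

/-- Only commutation across X and Y is needed; the entries of X need not commute with one another.
-/
theorem EntriesCommute.adj_mul {X Y : Matrix (Fin 2) (Fin 2) R} (h : EntriesCommute X Y) :
    adj (X * Y) = adj Y * adj X := by
  ext i j
  fin_cases i <;> fin_cases j <;>
    simp [adj, Matrix.mul_apply, Fin.sum_univ_two, (h _ _ _ _).eq, add_comm]

variable [Algebra ℂ R]

/-- `X (adj Y) = δ`: the quantum determinant relations, when `Y` is the argument-shifted `X`. -/
def QDet (δ : ℂ) (X Y : Matrix (Fin 2) (Fin 2) R) : Prop :=
  X * adj Y = (algebraMap ℂ R δ) • (1 : Matrix (Fin 2) (Fin 2) R)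

/-- The outer two components are the quantum determinant relations. The other two are carried along
because passing to products needs the whole matrix identity. -/
theorem qDet_iff {δ : ℂ} {X Y : Matrix (Fin 2) (Fin 2) R} :
    QDet δ X Y ↔ X 0 0 * Y 1 1 - X 0 1 * Y 1 0 = δ • 1 ∧ X 0 1 * Y 0 0 = X 0 0 * Y 0 1 ∧
      X 1 0 * Y 1 1 = X 1 1 * Y 1 0 ∧ X 1 1 * Y 0 0 - X 1 0 * Y 0 1 = δ • 1 := by
  unfold QDet
  rw [← Matrix.ext_iff]
  simp only [Fin.forall_fin_two, Matrix.mul_apply, Fin.sum_univ_two, adj, Matrix.smul_apply,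
    Matrix.of_apply, Matrix.cons_val', Matrix.cons_val_zero, Matrix.cons_val_one,
    Matrix.one_apply, smul_eq_mul, Algebra.smul_def]
  simp only [Fin.isValue, mul_neg, ← sub_eq_add_neg, ite_true, mul_one,
    zero_ne_one, one_ne_zero, if_false, mul_zero, neg_add_eq_sub, sub_eq_zero]
  tauto

theorem QDet.mul {δ δ' : ℂ} {X Y X' Y' : Matrix (Fin 2) (Fin 2) R}
    (h : QDet δ X Y) (h' : QDet δ' X' Y') (hY : EntriesCommute Y Y') :
    QDet (δ * δ') (X * X') (Y * Y') := by
  unfold QDet at *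
  have hc (r : ℂ) (Z : Matrix (Fin 2) (Fin 2) R) :
      Z * ((algebraMap ℂ R r) • (1 : Matrix (Fin 2) (Fin 2) R)) = (algebraMap ℂ R r) • Z := by
    ext i j
    simp only [Matrix.mul_apply, Matrix.smul_apply, Matrix.one_apply, smul_eq_mul, mul_ite,
      mul_one, mul_zero, Finset.sum_ite_eq', Finset.mem_univ, if_true, Algebra.commutes]
  calc X * X' * adj (Y * Y') = X * (X' * adj Y') * adj Y := by
        rw [hY.adj_mul]; simp only [mul_assoc]
    _ = (algebraMap ℂ R δ') • (X * adj Y) := by rw [h', hc, smul_mul_assoc]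
    _ = _ := by rw [h, smul_smul, ← map_mul, mul_comm]

theorem QDet.map {S : Type*} [Ring S] [Algebra ℂ S] (f : R →ₐ[ℂ] S) {δ : ℂ}
    {X Y : Matrix (Fin 2) (Fin 2) R} (h : QDet δ X Y) : QDet δ (X.map f) (Y.map f) := by
  rw [qDet_iff] at h ⊢
  obtain ⟨h1, h2, h3, h4⟩ := h
  refine ⟨?_, ?_, ?_, ?_⟩
  · simpa using congrArg f h1
  · simpa using congrArg f h2
  · simpa using congrArg f h3
  · simpa using congrArg f h4

end QuantumDeterminant

end YangBaxter

namespace XXZChain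

open Matrix YangBaxter

variable {N : ℕ} (c : XXZChain N)

/-! ### Operators acting on a single site -/

section Site

theorem sum_agree_off {M : Type*} [AddCommMonoid M] (n : Fin N) (h : c.Config)
    (f : c.Config → M) :
    (∑ k : c.Config, if ∀ m, m ≠ n → h m = k m then f k else 0) =
      ∑ j, f (Function.update h n j) := by
  rw [← Finset.sum_filter]
  refine Finset.sum_nbij' (fun k => k n) (fun j => Function.update h n j) ?_ ?_ ?_ ?_ ?_
  · simp
  · intro j _
    simp only [Finset.mem_filter, Finset.mem_univ, true_and]
    intro m hm
    rw [Function.update_of_ne hm]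
  · intro k hk
    simp only [Finset.mem_filter, Finset.mem_univ, true_and] at hk
    ext m
    by_cases hm : m = n
    · subst hm; simp
    · rw [Function.update_of_ne hm, hk m hm]
  · simp
  · intro k hk
    simp only [Finset.mem_filter, Finset.mem_univ, true_and] at hk
    congr 1
    ext m
    by_cases hm : m = n
    · subst hm; simp
    · rw [Function.update_of_ne hm, hk m hm]

theorem siteOp_mul_apply (n : Fin N) (M : Matrix (Fin (c.twoS n + 1)) (Fin (c.twoS n + 1)) ℂ)
    (X : c.Op) (h k : c.Config) :
    (c.siteOp n M * X) h k = ∑ j, M (h n) j * X (Function.update h n j) k := by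
  have := c.sum_agree_off n h fun l => M (h n) (l n) * X l k
  simp only [Function.update_self] at this
  rw [← this, Matrix.mul_apply]
  refine Finset.sum_congr rfl fun l _ => ?_
  simp only [siteOp, Matrix.of_apply, ite_mul, zero_mul]

/-- The embedding of the operators on the site `n`, as a morphism of algebras. -/
noncomputable def siteHom (n : Fin N) :
    Matrix (Fin (c.twoS n + 1)) (Fin (c.twoS n + 1)) ℂ →ₐ[ℂ] c.Op :=
  AlgHom.ofLinearMap
    { toFun := c.siteOp n
      map_add' := fun X Y => by
        ext h k
        simp only [siteOp, Matrix.of_apply, Matrix.add_apply]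
        split_ifs <;> simp
      map_smul' := fun r X => by
        ext h k
        simp [siteOp] }
    (by
      ext h k
      simp only [LinearMap.coe_mk, AddHom.coe_mk, siteOp, Matrix.of_apply, Matrix.one_apply]
      by_cases hk : h = k
      · simp [hk]
      · rw [if_neg hk, ← ite_and, if_neg]
        rintro ⟨h1, h2⟩
        refine hk (funext fun m => ?_)
        by_cases hm : m = n
        · rw [hm, h2]
        · exact h1 m hm)
    (by
      intro X Y
      ext h k
      simp only [LinearMap.coe_mk, AddHom.coe_mk]
      rw [siteOp_mul_apply]
      have this (j : Fin (c.twoS n + 1)) : (∀ m, m ≠ n → Function.update h n j m = k m) ↔ ∀ m, m ≠ n → h m = k m :=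
        forall₂_congr fun m hm => by rw [Function.update_of_ne hm]
      simp only [siteOp, Matrix.of_apply, this, Function.update_self, Matrix.mul_apply]
      split_ifs <;> simp)

theorem siteOp_commute {m n : Fin N} (hmn : m ≠ n)
    (X : Matrix (Fin (c.twoS m + 1)) (Fin (c.twoS m + 1)) ℂ)
    (Y : Matrix (Fin (c.twoS n + 1)) (Fin (c.twoS n + 1)) ℂ) :
    Commute (c.siteOp m X) (c.siteOp n Y) := by
  -- This expression is symmetric under exchanging (m, X) with (n, Y), which is the commutation.
  have key (m n : Fin N) (hmn : m ≠ n) (X Y) (h k : c.Config) :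
      (c.siteOp m X * c.siteOp n Y) h k =
        if ∀ l, l ≠ m → l ≠ n → h l = k l then X (h m) (k m) * Y (h n) (k n) else 0 := by
    rw [siteOp_mul_apply, Finset.sum_eq_single (k m)]
    · have : (∀ l, l ≠ n → Function.update h m (k m) l = k l) ↔
          ∀ l, l ≠ m → l ≠ n → h l = k l := by
        refine forall_congr' fun l => ?_
        by_cases hl : l = m
        · subst hl; simp
        · simp [hl]
      simp only [siteOp, Matrix.of_apply, this, Function.update_of_ne hmn.symm, mul_ite, mul_zero]
    · intro j _ hj
      simp only [siteOp, Matrix.of_apply, mul_ite, mul_zero]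
      rw [if_neg]
      intro H
      exact hj (by simpa using H m hmn)
    · simp
  ext h k
  rw [key m n hmn, key n m hmn.symm, mul_comm]
  congr 1
  exact propext ⟨fun H l a b => H l b a, fun H l a b => H l b a⟩

end Site

/-! ### Relations for a single Lax operator -/

section Local

/-- The Lax operator at the site `n`, as a matrix of operators on the space of that site. -/
noncomputable def localLax (n : Fin N) (u : ℂ) :
    Matrix (Fin 2) (Fin 2) (Matrix (Fin (c.twoS n + 1)) (Fin (c.twoS n + 1)) ℂ) :=
  !![c.sinhSz n u c.η, Complex.sinh c.η • c.Sminus n;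
     Complex.sinh c.η • c.Splus n, c.sinhSz n u (-c.η)]

theorem lax_eq_map (n : Fin N) (u : ℂ) : c.Lax n u = (c.localLax n u).map (c.siteHom n) := by
  ext i j : 2
  fin_cases i <;> fin_cases j <;> rfl

variable {c}

theorem Generic.sinh_ne_zero (hη : c.Generic) {m : ℕ} (hm : 0 < m) :
    Complex.sinh (m * c.η) ≠ 0 := by
  intro h
  refine hη (2 * m) (by positivity) ?_
  rw [← Complex.exp_nat_mul]
  have h2 : Complex.exp (m * c.η) = Complex.exp (-(m * c.η)) := by
    rw [Complex.sinh] at h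
    linear_combination 2 * h
  push_cast
  rw [show (2 * m * c.η : ℂ) = m * c.η + m * c.η by ring, Complex.exp_add]
  nth_rw 2 [h2]
  rw [← Complex.exp_add]
  simp

theorem Generic.sinh_eta_ne_zero (hη : c.Generic) : Complex.sinh c.η ≠ 0 := by
  simpa using hη.sinh_ne_zero one_pos

theorem RootsLadder.sinh_sq (hη : c.Generic) (hx : c.RootsLadder) (n : Fin N) (k : ℕ)
    (hk : 1 ≤ k) (hk' : k ≤ c.twoS n) :
    Complex.sinh c.η ^ 2 * c.x n k ^ 2 =
      Complex.sinh (k * c.η) * Complex.sinh ((2 * c.s n + 1 - k) * c.η) := by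
  have h0 := hη.sinh_eta_ne_zero
  rw [hx n k hk hk', qInt, qInt, Nat.cast_sub (by omega)]
  have : (2 * c.s n + 1 - k) = ((c.twoS n + 1 : ℕ) : ℂ) - k := by
    rw [s]; push_cast; ring
  rw [this]
  field_simp

/-- At k = 0 here, and at k = 2s in `Splus_mul_Sminus`, the matrix product has no contributing term
and a sinh factor vanishes. So `x` enters only at indices 1, …, 2s. -/
theorem Sminus_mul_Splus (hη : c.Generic) (hx : c.RootsLadder) (n : Fin N) :
    (Complex.sinh c.η • c.Sminus n) * (Complex.sinh c.η • c.Splus n) =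
      Matrix.diagonal fun k : Fin (c.twoS n + 1) =>
        Complex.sinh ((k : ℕ) * c.η) * Complex.sinh ((2 * c.s n + 1 - (k : ℕ)) * c.η) := by
  ext i j
  rw [Matrix.mul_apply]
  simp only [Matrix.smul_apply, Sminus, Splus, Matrix.of_apply, smul_eq_mul, mul_ite, mul_zero,
    ite_mul, zero_mul, Matrix.diagonal_apply]
  by_cases h0 : (i : ℕ) = 0
  · rw [Finset.sum_eq_zero]
    · simp [h0]
    · intro l _
      simp [show ¬(i : ℕ) = l + 1 by omega]
  · rw [Finset.sum_eq_single (⟨i - 1, by omega⟩ : Fin (c.twoS n + 1))]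
    · by_cases hij : i = j
      · subst hij
        rw [if_pos (by simp; omega), if_pos (by simp; omega), if_pos rfl,
          ← hx.sinh_sq hη n i (by omega) (by omega)]
        ring
      · rw [if_neg hij, if_neg]
        simp only
        have : (i : ℕ) ≠ j := fun h => hij (Fin.ext h)
        omega
    · intro l _ hl
      have : (i : ℕ) ≠ l + 1 := by
        intro h
        apply hl
        ext
        simp; omega
      simp [this]
    · simp

theorem Splus_mul_Sminus (hη : c.Generic) (hx : c.RootsLadder) (n : Fin N) :
    (Complex.sinh c.η • c.Splus n) * (Complex.sinh c.η • c.Sminus n) =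
      Matrix.diagonal fun k : Fin (c.twoS n + 1) =>
        Complex.sinh (((k : ℕ) + 1) * c.η) * Complex.sinh ((2 * c.s n - (k : ℕ)) * c.η) := by
  ext i j
  rw [Matrix.mul_apply]
  simp only [Matrix.smul_apply, Sminus, Splus, Matrix.of_apply, smul_eq_mul, mul_ite, mul_zero,
    ite_mul, zero_mul, Matrix.diagonal_apply]
  by_cases h0 : (i : ℕ) = c.twoS n
  · rw [Finset.sum_eq_zero]
    · rw [h0, s]
      simp [mul_div_cancel₀]
    · intro l _
      simp [show ¬(l : ℕ) = i + 1 by omega]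
  · rw [Finset.sum_eq_single (⟨i + 1, by omega⟩ : Fin (c.twoS n + 1))]
    · by_cases hij : i = j
      · subst hij
        have := hx.sinh_sq hη n (i + 1) (by omega) (by omega)
        push_cast at this
        rw [if_pos rfl, if_pos rfl, if_pos rfl,
          show (2 * c.s n - (i : ℕ)) = 2 * c.s n + 1 - ((i : ℕ) + 1) by ring, ← this]
        ring
      · rw [if_neg hij, if_neg]
        simp only
        have : (i : ℕ) ≠ j := fun h => hij (Fin.ext h)
        omega
    · intro l _ hl
      have : (l : ℕ) ≠ i + 1 := by
        intro h
        apply hl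
        ext
        simp; omega
      simp [this]
    · simp

theorem sinhSz_mul_Sminus (n : Fin N) (u η : ℂ) :
    c.sinhSz n u η * (Complex.sinh c.η • c.Sminus n) =
      (Complex.sinh c.η • c.Sminus n) * c.sinhSz n (u - η) η := by
  ext i j
  simp only [sinhSz, Sminus, Matrix.diagonal_mul, Matrix.mul_diagonal, Matrix.smul_apply,
    Matrix.of_apply, smul_eq_mul, mul_ite, ite_mul, mul_zero, zero_mul]
  split_ifs with h
  · rw [h]
    push_cast
    rw [mul_comm]
    congr 2
    ring
  · rfl

theorem Splus_mul_sinhSz (n : Fin N) (u η : ℂ) :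
    (Complex.sinh c.η • c.Splus n) * c.sinhSz n u η =
      c.sinhSz n (u - η) η * (Complex.sinh c.η • c.Splus n) := by
  ext i j
  simp only [sinhSz, Splus, Matrix.diagonal_mul, Matrix.mul_diagonal, Matrix.smul_apply,
    Matrix.of_apply, smul_eq_mul, mul_ite, ite_mul, mul_zero, zero_mul]
  split_ifs with h
  · rw [h]
    push_cast
    rw [mul_comm]
    congr 2
    ring
  · rfl

theorem sinhSz_mul_sinhSz (n : Fin N) (u η u' η' : ℂ) :
    c.sinhSz n u η * c.sinhSz n u' η' = Matrix.diagonal fun k : Fin (c.twoS n + 1) =>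
      Complex.sinh (u + η * (c.s n - ((k : ℕ) : ℂ))) *
        Complex.sinh (u' + η' * (c.s n - ((k : ℕ) : ℂ))) := by
  simp [sinhSz]

theorem sinhSz_commute (n : Fin N) (u η u' η' : ℂ) :
    Commute (c.sinhSz n u η) (c.sinhSz n u' η') := by
  rw [commute_iff_eq, sinhSz_mul_sinhSz, sinhSz_mul_sinhSz]
  simp_rw [mul_comm]

end Local

section Hyperbolic

open Complex

theorem sinh_mul_sinh_eq (p q : ℂ) : sinh p * sinh q = (cosh (p + q) - cosh (p - q)) / 2 := by
  rw [cosh_add, cosh_sub]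
  ring

theorem sinh_three_term (p q r : ℂ) :
    sinh (p + q) * sinh r = sinh p * sinh (q + r) + sinh q * sinh (r - p) := by
  simp only [sinh_mul_sinh_eq]
  rw [show q - (r - p) = p + q - r by ring, show q + (r - p) = -(p - (q + r)) by ring, cosh_neg,
    show p + (q + r) = p + q + r by ring]
  ring

theorem sinh_mul_sinh_sub {p q r s t w : ℂ} (h1 : p + q = t + w) (h2 : p - q = s - r)
    (h3 : r + s = t - w) : sinh p * sinh q - sinh r * sinh s = sinh t * sinh w := by
  simp only [sinh_mul_sinh_eq]
  rw [h1, h2, h3, ← cosh_neg (s - r), neg_sub]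
  ring

theorem sinh_mul_sinh_sub_of_add_eq {p q r s t w : ℂ} (h1 : p + q = r + s) (h2 : r - s = t + w)
    (h3 : p - q = t - w) : sinh p * sinh q - sinh r * sinh s = sinh t * sinh w := by
  simp only [sinh_mul_sinh_eq]
  rw [h1, h2, h3]
  ring

theorem smul_sinhSz_three_term (n : Fin N) (η : ℂ) {p q r t r₁ r₂ : ℂ} (ht : t = p + q)
    (h₁ : r₁ = q + r) (h₂ : r₂ = r - p) :
    sinh t • c.sinhSz n r η = sinh p • c.sinhSz n r₁ η + sinh q • c.sinhSz n r₂ η := by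
  subst ht h₁ h₂
  ext i j
  simp only [sinhSz, Matrix.add_apply, Matrix.smul_apply, Matrix.diagonal_apply]
  split_ifs
  · simp only [smul_eq_mul]
    rw [sinh_three_term]
    congr 3 <;> ring
  · simp

end Hyperbolic

section LocalRelations

open Complex

variable {c}

theorem exchange_localLax (hη : c.Generic) (hx : c.RootsLadder) (n : Fin N) (u v : ℂ) :
    Exchange (sinh (u - v + c.η)) (sinh (u - v)) (sinh c.η) (c.localLax n u)
      (c.localLax n v) := by
  -- The component that carries the quantum group commutator of S⁺ and S⁻.
  have hEF : sinh (u - v) • ((sinh c.η • c.Sminus n) * (sinh c.η • c.Splus n)) +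
      sinh c.η • (c.sinhSz n u (-c.η) * c.sinhSz n v c.η) =
      sinh (u - v) • ((sinh c.η • c.Splus n) * (sinh c.η • c.Sminus n)) +
      sinh c.η • (c.sinhSz n v (-c.η) * c.sinhSz n u c.η) := by
    rw [Sminus_mul_Splus hη hx, Splus_mul_Sminus hη hx, sinhSz_mul_sinhSz, sinhSz_mul_sinhSz]
    ext i j
    simp only [Matrix.add_apply, Matrix.smul_apply, Matrix.diagonal_apply, smul_eq_mul]
    split_ifs
    · generalize ((i : ℕ) : ℂ) = k
      have h1 := sinh_mul_sinh_sub_of_add_eq (p := (2 * c.s n - k) * c.η) (q := (k + 1) * c.η)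
        (r := (2 * c.s n + 1 - k) * c.η) (s := k * c.η) (t := 2 * (c.s n - k) * c.η)
        (w := c.η) (by ring) (by ring) (by ring)
      have h2 := sinh_mul_sinh_sub_of_add_eq (p := u + -c.η * (c.s n - k))
        (q := v + c.η * (c.s n - k)) (r := u + c.η * (c.s n - k)) (s := v + -c.η * (c.s n - k))
        (t := u - v) (w := 2 * (c.s n - k) * c.η) (by ring) (by ring) (by ring)
      linear_combination -sinh (u - v) * h1 + sinh c.η * h2
    · simp
  -- Once diagonal operators are moved to the right of S⁻ and to the left of S⁺, the components with
  -- a single ladder operator are the three-term sinh identity times S⁻ or S⁺. The two alternatives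
  -- in the hypothesis are the two directions of the shifts.
  have hE {E : Matrix (Fin (c.twoS n + 1)) (Fin (c.twoS n + 1)) ℂ} {η r r₁ r₂ : ℂ}
      (h : r₁ = c.η + r ∧ r₂ = r - (u - v) ∨ r₁ = r - c.η ∧ r₂ = r + (u - v)) :
      sinh (u - v + c.η) • (E * c.sinhSz n r η) =
        sinh (u - v) • (E * c.sinhSz n r₁ η) + sinh c.η • (E * c.sinhSz n r₂ η) := by
    simp only [← mul_smul_comm, ← mul_add]
    congr 1
    rcases h with ⟨h₁, h₂⟩ | ⟨h₁, h₂⟩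
    · exact c.smul_sinhSz_three_term n η rfl h₁ h₂
    · rw [add_comm (sinh (u - v) • _)]
      exact c.smul_sinhSz_three_term n η (add_comm _ _) (by rw [h₂]; ring) h₁
  have hF {F : Matrix (Fin (c.twoS n + 1)) (Fin (c.twoS n + 1)) ℂ} {η r r₁ r₂ : ℂ}
      (h : r₁ = c.η + r ∧ r₂ = r - (u - v) ∨ r₁ = r - c.η ∧ r₂ = r + (u - v)) :
      sinh (u - v + c.η) • (c.sinhSz n r η * F) =
        sinh (u - v) • (c.sinhSz n r₁ η * F) + sinh c.η • (c.sinhSz n r₂ η * F) := by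
    simp only [← smul_mul_assoc, ← add_mul]
    congr 1
    rcases h with ⟨h₁, h₂⟩ | ⟨h₁, h₂⟩
    · exact c.smul_sinhSz_three_term n η rfl h₁ h₂
    · rw [add_comm (sinh (u - v) • _)]
      exact c.smul_sinhSz_three_term n η (add_comm _ _) (by rw [h₂]; ring) h₁
  rw [exchange_iff]
  intro i i' k k'
  fin_cases i <;> fin_cases i' <;> fin_cases k <;> fin_cases k' <;>
    simp only [localLax, Fin.zero_eta, Fin.mk_one, Fin.isValue, zero_ne_one, one_ne_zero, if_true,
      if_false, Matrix.of_apply, Matrix.cons_val', Matrix.cons_val_zero, Matrix.cons_val_one,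
      Matrix.cons_val_fin_one, sinhSz_mul_Sminus, Splus_mul_sinhSz,
      (sinhSz_commute n u c.η v c.η).eq, (sinhSz_commute n u (-c.η) v (-c.η)).eq,
      (sinhSz_commute n _ c.η _ (-c.η)).eq]
  · exact hE (Or.inl ⟨by ring, by ring⟩)
  · exact hE (Or.inr ⟨by ring, by ring⟩)
  · exact (hF (Or.inl ⟨by ring, by ring⟩)).symm
  · exact hEF
  · exact (hE (Or.inr ⟨by ring, by ring⟩)).symm
  · exact (hF (Or.inr ⟨by ring, by ring⟩)).symm
  · exact hEF.symm
  · exact (hE (Or.inl ⟨by ring, by ring⟩)).symm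
  · exact hF (Or.inr ⟨by ring, by ring⟩)
  · exact hF (Or.inl ⟨by ring, by ring⟩)

theorem qDet_localLax (hη : c.Generic) (hx : c.RootsLadder) (n : Fin N) (u : ℂ) :
    QDet (sinh (u + c.s n * c.η) * sinh (u - c.η - c.s n * c.η)) (c.localLax n u)
      (c.localLax n (u - c.η)) := by
  rw [qDet_iff]
  simp only [localLax, Matrix.of_apply, Matrix.cons_val', Matrix.cons_val_zero,
    Matrix.cons_val_one, Matrix.cons_val_fin_one, sinhSz_mul_Sminus, Splus_mul_sinhSz,
    sub_neg_eq_add, sub_add_cancel, true_and,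
    Sminus_mul_Splus hη hx, Splus_mul_Sminus hη hx, sinhSz_mul_sinhSz]
  constructor
  · ext i j
    simp only [Matrix.sub_apply, Matrix.smul_apply, Matrix.diagonal_apply, Matrix.one_apply,
      smul_eq_mul]
    split_ifs
    · rw [mul_one]
      refine sinh_mul_sinh_sub ?_ ?_ ?_ <;> ring
    · simp
  · ext i j
    simp only [Matrix.sub_apply, Matrix.smul_apply, Matrix.diagonal_apply, Matrix.one_apply,
      smul_eq_mul]
    split_ifs
    · rw [mul_one, mul_comm (sinh ((((i : ℕ) : ℂ) + 1) * c.η))]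
      refine sinh_mul_sinh_sub ?_ ?_ ?_ <;> ring
    · simp

end LocalRelations

end XXZChain

/-! ### Trigonometric polynomials and interpolation -/

section TrigPoly

open Complex Polynomial

/-- `f` is a linear combination of `e ^ ((n - 1) u), e ^ ((n - 3) u), …, e ^ (-(n - 1) u)`. -/
def IsTrigPoly (n : ℕ) (f : ℂ → ℂ) : Prop :=
  ∃ p ∈ degreeLT ℂ n, ∀ u, exp (n * u) * f u = exp u * p.eval (exp (2 * u))

namespace IsTrigPoly

variable {n : ℕ} {f g : ℂ → ℂ}

theorem zero (n : ℕ) : IsTrigPoly n fun _ => 0 :=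
  ⟨0, Submodule.zero_mem _, by simp⟩

theorem add (hf : IsTrigPoly n f) (hg : IsTrigPoly n g) : IsTrigPoly n fun u => f u + g u := by
  obtain ⟨p, hp, hf⟩ := hf
  obtain ⟨q, hq, hg⟩ := hg
  exact ⟨p + q, Submodule.add_mem _ hp hq, fun u => by simp [mul_add, hf, hg]⟩

theorem mul_const (hf : IsTrigPoly n f) (r : ℂ) : IsTrigPoly n fun u => f u * r := by
  obtain ⟨p, hp, hf⟩ := hf
  exact ⟨r • p, Submodule.smul_mem _ _ hp, fun u => by
    rw [← mul_assoc, hf, eval_smul, smul_eq_mul]; ring⟩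

theorem const_mul (hf : IsTrigPoly n f) (r : ℂ) : IsTrigPoly n fun u => r * f u := by
  simpa only [mul_comm] using hf.mul_const r

theorem sum {ι : Type*} (s : Finset ι) {F : ι → ℂ → ℂ} (h : ∀ i ∈ s, IsTrigPoly n (F i)) :
    IsTrigPoly n fun u => ∑ i ∈ s, F i u := by
  classical
  induction s using Finset.induction_on with
  | empty => simpa using zero n
  | insert i s hi ih =>
    simp only [Finset.sum_insert hi]
    exact (h _ (Finset.mem_insert_self _ _)).add
      (ih fun j hj => h _ (Finset.mem_insert_of_mem hj))

theorem const (r : ℂ) : IsTrigPoly 1 fun _ => r :=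
  ⟨C r, mem_degreeLT.2 (degree_C_le.trans_lt (by norm_num)), by simp⟩

theorem sinh_add_const (w : ℂ) : IsTrigPoly 2 fun u => sinh (u + w) := by
  refine ⟨C (exp w / 2) * X - C (exp (-w) / 2), Submodule.sub_mem _ (mem_degreeLT.2 ?_)
    (mem_degreeLT.2 (degree_C_le.trans_lt (by norm_num))), fun u => ?_⟩
  · exact (degree_C_mul_X_le _).trans_lt (by norm_num)
  · simp only [eval_sub, eval_mul, eval_C, eval_X, Complex.sinh, neg_add, exp_add, Nat.cast_ofNat,
      two_mul]
    have : exp u * exp (-u) = 1 := by rw [← exp_add]; simp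
    linear_combination (-(exp u * exp (-w)) / 2) * this

/-- The index counts frequencies, one more than the degree in e^(2u); hence the sum of the indices
minus one. -/
theorem mul {m : ℕ} (hf : IsTrigPoly (m + 1) f) (hg : IsTrigPoly n g) :
    IsTrigPoly (m + n) fun u => f u * g u := by
  obtain ⟨p, hp, hf⟩ := hf
  obtain ⟨q, hq, hg⟩ := hg
  refine ⟨p * q, mem_degreeLT.2 ?_, fun u => ?_⟩
  · rw [mem_degreeLT] at hp hq
    by_cases hp0 : p = 0
    · subst hp0
      simp
    by_cases hq0 : q = 0
    · subst hq0
      simp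
    rw [← natDegree_lt_iff_degree_lt hp0] at hp
    rw [← natDegree_lt_iff_degree_lt hq0] at hq
    rw [← natDegree_lt_iff_degree_lt (mul_ne_zero hp0 hq0), natDegree_mul hp0 hq0]
    omega
  · have h := congrArg₂ (· * ·) (hf u) (hg u)
    simp only [Nat.cast_add, Nat.cast_one, add_mul, one_mul, exp_add] at h
    apply mul_left_cancel₀ (exp_ne_zero u)
    rw [eval_mul]
    push_cast
    rw [add_mul, exp_add]
    linear_combination h

/-- One frequency is added at each end: the parity of the exponents is fixed, so the index can only
grow by two. -/
theorem lift (hf : IsTrigPoly n f) : IsTrigPoly (n + 2) f := by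
  obtain ⟨p, hp, hf⟩ := hf
  refine ⟨X * p, ?_, fun u => ?_⟩
  · by_cases hp0 : p = 0
    · simp [hp0]
    rw [mem_degreeLT] at hp ⊢
    rw [← natDegree_lt_iff_degree_lt hp0] at hp
    rw [← natDegree_lt_iff_degree_lt (mul_ne_zero X_ne_zero hp0), natDegree_X_mul hp0]
    omega
  · push_cast
    rw [eval_mul, eval_X, add_mul, exp_add]
    linear_combination exp (2 * u) * hf u

theorem prod_sinh {ι : Type*} (s : Finset ι) (x y : ι → ℂ) :
    IsTrigPoly (s.card + 1) fun u => ∏ i ∈ s, sinh (u - x i) / y i := by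
  classical
  induction s using Finset.induction_on with
  | empty => simpa using const 1
  | insert i s hi ih =>
    simp only [Finset.prod_insert hi, Finset.card_insert_of_notMem hi]
    have := ((sinh_add_const (-x i)).mul_const (y i)⁻¹).mul ih
    rw [add_comm]
    simpa only [sub_eq_add_neg, div_eq_mul_inv] using this

theorem continuous (hf : IsTrigPoly n f) : Continuous f := by
  obtain ⟨p, hp, hf⟩ := hf
  have : f = fun u => exp (-(n * u)) * (exp u * p.eval (exp (2 * u))) := by
    ext u
    rw [← hf, ← mul_assoc, ← exp_add]
    simp
  rw [this]
  fun_prop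

/-- The hypothesis on sinh makes the N numbers e^(2 x_a) distinct, and they are roots of a
polynomial of degree less than N. -/
theorem eq_zero_of_roots {N : ℕ} {x : Fin N → ℂ} (hf : IsTrigPoly N f)
    (hx : ∀ a b, a ≠ b → sinh (x a - x b) ≠ 0) (h : ∀ a, f (x a) = 0) (u : ℂ) : f u = 0 := by
  obtain ⟨p, hp, hf⟩ := hf
  have hp0 : p = 0 := by
    refine eq_zero_of_degree_lt_of_eval_index_eq_zero (s := Finset.univ)
      (v := fun a => exp (2 * x a)) ?_ (by simpa using mem_degreeLT.1 hp) ?_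
    · intro a _ b _ hab
      by_contra hne
      apply hx a b hne
      simp only [two_mul, exp_add] at hab
      have ha : exp (x a) * exp (-x a) = 1 := by rw [← exp_add]; simp
      have hb : exp (x b) * exp (-x b) = 1 := by rw [← exp_add]; simp
      rw [Complex.sinh, neg_sub, sub_eq_add_neg (x a), sub_eq_add_neg (x b), exp_add, exp_add]
      linear_combination (exp (-x a) * exp (-x b) / 2) * hab +
        exp (x b) * exp (-x a) / 2 * hb - exp (x a) * exp (-x b) / 2 * ha
    · intro a _
      have := hf (x a)
      rw [h, mul_zero, eq_comm, mul_eq_zero] at this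
      exact this.resolve_left (exp_ne_zero _)
  have := hf u
  rw [hp0, eval_zero, mul_zero, mul_eq_zero] at this
  exact this.resolve_left (exp_ne_zero _)

/-- Trigonometric Lagrange interpolation. -/
theorem eq_interpolation {N : ℕ} {x : Fin N → ℂ} (hf : IsTrigPoly N f)
    (hx : ∀ a b, a ≠ b → sinh (x a - x b) ≠ 0) (u : ℂ) :
    f u = ∑ a, (∏ b ∈ Finset.univ.erase a, sinh (u - x b) / sinh (x a - x b)) * f (x a) := by
  -- A Lagrange term has N - 1 sinh factors, hence N frequencies, so the interpolation error again
  -- has index N and vanishes at the N nodes.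
  have hg : IsTrigPoly N fun u => f u + -1 *
      ∑ a, (∏ b ∈ Finset.univ.erase a, sinh (u - x b) / sinh (x a - x b)) * f (x a) := by
    refine hf.add (const_mul (sum _ fun a _ => mul_const ?_ _) _)
    have := prod_sinh (Finset.univ.erase a) x fun b => sinh (x a - x b)
    have hN : 0 < N := a.pos
    rwa [Finset.card_erase_of_mem (Finset.mem_univ _), Finset.card_univ, Fintype.card_fin,
      Nat.sub_add_cancel hN] at this
  have := hg.eq_zero_of_roots hx (fun a => ?_) u
  · linear_combination this
  · rw [Finset.sum_eq_single a]
    · rw [Finset.prod_eq_one]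
      · ring
      · intro b hb
        exact div_self (hx a b (Finset.ne_of_mem_erase hb).symm)
    · intro b _ hb
      rw [Finset.prod_eq_zero (Finset.mem_erase.2 ⟨hb.symm, Finset.mem_univ _⟩), zero_mul]
      simp
    · simp

end IsTrigPoly

end TrigPoly

/-- Where f is nonzero it is so on a neighbourhood, on which sinh (u - w) would vanish. By the
identity theorem it would vanish everywhere, yet sinh 1 ≠ 0. -/
theorem eq_zero_of_mul_sinh_eq_zero {f : ℂ → ℂ} (hf : Continuous f) (w : ℂ)
    (h : ∀ u, f u * Complex.sinh (u - w) = 0) : f = 0 := by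
  by_contra hne
  obtain ⟨u, hu⟩ := Function.ne_iff.1 hne
  have han : AnalyticOnNhd ℂ (fun u => Complex.sinh (u - w)) Set.univ := fun z _ => by fun_prop
  have hev : (fun u => Complex.sinh (u - w)) =ᶠ[nhds u] 0 := by
    filter_upwards [hf.continuousAt.eventually_ne hu] with z hz
    exact (mul_eq_zero.1 (h z)).resolve_left hz
  have := han.eqOn_zero_of_preconnected_of_eventuallyEq_zero isPreconnected_univ
    (Set.mem_univ u) hev (Set.mem_univ (w + 1))
  simp only [add_sub_cancel_left, Pi.zero_apply] at this
  have h1 : Complex.sinh 1 = ((Real.sinh 1 : ℝ) : ℂ) := by simp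
  rw [h1, Complex.ofReal_eq_zero, Real.sinh_eq_zero] at this
  exact one_ne_zero this

theorem eq_zero_of_mul_prod_sinh_eq_zero {ι : Type*} (s : Finset ι) {f : ℂ → ℂ}
    (hf : Continuous f) (w : ι → ℂ) (h : ∀ u, f u * ∏ i ∈ s, Complex.sinh (u - w i) = 0) :
    f = 0 := by
  classical
  induction s using Finset.induction_on with
  | empty => ext u; simpa using h u
  | insert i s hi ih =>
    refine ih fun u => congrFun (eq_zero_of_mul_sinh_eq_zero (f := fun u =>
      f u * ∏ i ∈ s, Complex.sinh (u - w i)) ?_ (w i) fun u => ?_) u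
    · fun_prop
    · rw [← h u, Finset.prod_insert hi]
      ring

namespace XXZChain

open Matrix YangBaxter

variable {N : ℕ} (c : XXZChain N)

/-! ### From one site to the chain: the Yang-Baxter relations -/

section PartialMonodromy

/-- The product of the Lax operators over a list of sites. -/
noncomputable def listMonodromy (l : List (Fin N)) (u : ℂ) : Matrix (Fin 2) (Fin 2) c.Op :=
  (l.map fun n => c.Lax n (u - c.ξ n)).prod

theorem listMonodromy_nil (u : ℂ) : c.listMonodromy [] u = 1 := rfl

theorem listMonodromy_cons (n : Fin N) (l : List (Fin N)) (u : ℂ) :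
    c.listMonodromy (n :: l) u = c.Lax n (u - c.ξ n) * c.listMonodromy l u := by
  simp [listMonodromy]

theorem monodromy_eq (u : ℂ) :
    c.monodromy u = c.listMonodromy (List.finRange N).reverse u := by
  rw [monodromy, listMonodromy, List.ofFn_eq_map, List.map_reverse]

theorem entriesCommute_lax {m n : Fin N} (hmn : m ≠ n) (u v : ℂ) :
    EntriesCommute (c.Lax m u) (c.Lax n v) := by
  intro i j k l
  rw [lax_eq_map, lax_eq_map]
  exact c.siteOp_commute hmn _ _

theorem entriesCommute_listMonodromy {n : Fin N} {l : List (Fin N)} (hn : n ∉ l) (u v : ℂ) :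
    EntriesCommute (c.Lax n u) (c.listMonodromy l v) := by
  induction l with
  | nil =>
    intro i j k l
    rw [listMonodromy_nil, Matrix.one_apply]
    split_ifs
    · exact Commute.one_right _
    · exact Commute.zero_right _
  | cons m l ih =>
    rw [List.mem_cons, not_or] at hn
    rw [listMonodromy_cons]
    exact (c.entriesCommute_lax hn.1 _ _).mul_right (ih hn.2)

theorem nodup_finRange_reverse : (List.finRange N).reverse.Nodup :=
  List.nodup_reverse.2 (List.nodup_finRange N)

end PartialMonodromy

section Relations

open Complex

variable {c}

/-- The weights depend only on u - v, so the same six-vertex matrix serves every site, whatever its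
inhomogeneity. -/
theorem exchange_listMonodromy (hη : c.Generic) (hx : c.RootsLadder) {l : List (Fin N)}
    (hl : l.Nodup) (u v : ℂ) :
    Exchange (sinh (u - v + c.η)) (sinh (u - v)) (sinh c.η) (c.listMonodromy l u)
      (c.listMonodromy l v) := by
  induction l with
  | nil => exact Exchange.one _ _ _
  | cons n l ih =>
    rw [List.nodup_cons] at hl
    rw [listMonodromy_cons, listMonodromy_cons]
    refine Exchange.mul ?_ (ih hl.2) (c.entriesCommute_listMonodromy hl.1 _ _)
      (c.entriesCommute_listMonodromy hl.1 _ _).symm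
    have := (exchange_localLax hη hx n (u - c.ξ n) (v - c.ξ n)).map (c.siteHom n)
    rwa [← lax_eq_map, ← lax_eq_map, sub_sub_sub_cancel_right] at this

theorem exchange_monodromy (hη : c.Generic) (hx : c.RootsLadder) (u v : ℂ) :
    Exchange (sinh (u - v + c.η)) (sinh (u - v)) (sinh c.η) (c.monodromy u) (c.monodromy v) := by
  rw [monodromy_eq, monodromy_eq]
  exact exchange_listMonodromy hη hx nodup_finRange_reverse u v

theorem qDet_listMonodromy (hη : c.Generic) (hx : c.RootsLadder) {l : List (Fin N)}
    (hl : l.Nodup) (u : ℂ) :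
    QDet (l.map fun n => sinh (u - c.ξ n + c.s n * c.η) *
      sinh (u - c.η - c.ξ n - c.s n * c.η)).prod (c.listMonodromy l u)
      (c.listMonodromy l (u - c.η)) := by
  induction l with
  | nil => simp [qDet_iff, listMonodromy_nil]
  | cons n l ih =>
    rw [List.nodup_cons] at hl
    rw [listMonodromy_cons, listMonodromy_cons, List.map_cons, List.prod_cons]
    refine QDet.mul ?_ (ih hl.2) (c.entriesCommute_listMonodromy hl.1 _ _)
    have := (qDet_localLax hη hx n (u - c.ξ n)).map (c.siteHom n)
    rwa [← lax_eq_map, ← lax_eq_map, sub_right_comm u (c.ξ n) c.η] at this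

theorem qDet_monodromy (hη : c.Generic) (hx : c.RootsLadder) (u : ℂ) :
    QDet (c.a u * c.d (u - c.η)) (c.monodromy u) (c.monodromy (u - c.η)) := by
  have h := qDet_listMonodromy hη hx nodup_finRange_reverse u
  rw [monodromy_eq, monodromy_eq]
  convert h using 1
  rw [a, d, ← Finset.prod_mul_distrib, Fin.prod_univ_def]
  exact (((List.reverse_perm _).map _).prod_eq).symm

/-- The exchange relation gives commutation up to the factor sinh (u - v + η). If this vanishes, u
and v are swapped; both factors cannot vanish, since their arguments add up to 2η and sinh (2η) ≠ 0.
-/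
theorem B_commute (hη : c.Generic) (hx : c.RootsLadder) (u v : ℂ) : Commute (c.B u) (c.B v) := by
  by_cases h : sinh (u - v + c.η) = 0
  · have h' : sinh (v - u + c.η) ≠ 0 := by
      intro h'
      apply hη.sinh_ne_zero two_pos
      have e : ((2 : ℕ) : ℂ) * c.η = (u - v + c.η) + (v - u + c.η) := by push_cast; ring
      rw [e, sinh_add, h, h', zero_mul, mul_zero, add_zero]
    have := exchange_iff.1 (exchange_monodromy hη hx v u) 0 0 1 1
    simp only [if_true] at this
    exact (smul_right_injective _ h' this).symm
  · have := exchange_iff.1 (exchange_monodromy hη hx u v) 0 0 1 1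
    simp only [if_true] at this
    exact smul_right_injective _ h this

theorem C_commute (hη : c.Generic) (hx : c.RootsLadder) (u v : ℂ) : Commute (c.C u) (c.C v) := by
  by_cases h : sinh (u - v + c.η) = 0
  · have h' : sinh (v - u + c.η) ≠ 0 := by
      intro h'
      apply hη.sinh_ne_zero two_pos
      have e : ((2 : ℕ) : ℂ) * c.η = (u - v + c.η) + (v - u + c.η) := by push_cast; ring
      rw [e, sinh_add, h, h', zero_mul, mul_zero, add_zero]
    have := exchange_iff.1 (exchange_monodromy hη hx v u) 1 1 0 0
    simp only [if_true] at this
    exact (smul_right_injective _ h' this).symm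
  · have := exchange_iff.1 (exchange_monodromy hη hx u v) 1 1 0 0
    simp only [if_true] at this
    exact smul_right_injective _ h this

theorem D_C_exchange (hη : c.Generic) (hx : c.RootsLadder) (u v : ℂ) :
    sinh (u - v + c.η) • (c.D u * c.C v) =
      sinh (u - v) • (c.C v * c.D u) + sinh c.η • (c.D v * c.C u) := by
  simpa [A, B, C, D] using exchange_iff.1 (exchange_monodromy hη hx u v) 1 1 1 0

theorem D_B_exchange (hη : c.Generic) (hx : c.RootsLadder) (u v : ℂ) :
    sinh (u - v) • (c.D u * c.B v) + sinh c.η • (c.B u * c.D v) =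
      sinh (u - v + c.η) • (c.B v * c.D u) := by
  simpa [A, B, C, D] using exchange_iff.1 (exchange_monodromy hη hx u v) 1 0 1 1

theorem C_B_exchange (hη : c.Generic) (hx : c.RootsLadder) (u v : ℂ) :
    sinh (u - v) • (c.C u * c.B v) + sinh c.η • (c.A u * c.D v) =
      sinh (u - v) • (c.B v * c.C u) + sinh c.η • (c.A v * c.D u) := by
  simpa [A, B, C, D] using exchange_iff.1 (exchange_monodromy hη hx u v) 1 0 0 1

theorem B_C_exchange (hη : c.Generic) (hx : c.RootsLadder) (u v : ℂ) :
    sinh (u - v) • (c.B u * c.C v) + sinh c.η • (c.D u * c.A v) =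
      sinh (u - v) • (c.C v * c.B u) + sinh c.η • (c.D v * c.A u) := by
  simpa [A, B, C, D] using exchange_iff.1 (exchange_monodromy hη hx u v) 0 1 1 0

theorem A_D_exchange (hη : c.Generic) (hx : c.RootsLadder) (u v : ℂ) :
    sinh (u - v) • (c.A u * c.D v) + sinh c.η • (c.C u * c.B v) =
      sinh (u - v) • (c.D v * c.A u) + sinh c.η • (c.C v * c.B u) := by
  simpa [A, B, C, D] using exchange_iff.1 (exchange_monodromy hη hx u v) 0 1 0 1

theorem qdet_A_D (hη : c.Generic) (hx : c.RootsLadder) (u : ℂ) :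
    c.A u * c.D (u - c.η) - c.B u * c.C (u - c.η) = (c.a u * c.d (u - c.η)) • (1 : c.Op) :=
  (qDet_iff.1 (qDet_monodromy hη hx u)).1

theorem qdet_D_A (hη : c.Generic) (hx : c.RootsLadder) (u : ℂ) :
    c.D u * c.A (u - c.η) - c.C u * c.B (u - c.η) = (c.a u * c.d (u - c.η)) • (1 : c.Op) :=
  (qDet_iff.1 (qDet_monodromy hη hx u)).2.2.2

/-- At spectral difference -η the two coefficients of `A_D_exchange` are opposite, which converts
`qdet_D_A` to a form where D(u) and B(u) act first. Applied to a ket killed by D(u), it evaluates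
C(u - η) B(u). -/
theorem qdet_A_D_shifted (hη : c.Generic) (hx : c.RootsLadder) (u : ℂ) :
    c.A (u - c.η) * c.D u - c.C (u - c.η) * c.B u = (c.a u * c.d (u - c.η)) • (1 : c.Op) := by
  rw [← qdet_D_A hη hx u]
  have h := A_D_exchange hη hx (u - c.η) u
  rw [sub_sub_cancel_left, sinh_neg] at h
  refine smul_right_injective _ (neg_ne_zero.2 hη.sinh_eta_ne_zero) ?_
  simp only [smul_sub, neg_smul, sub_neg_eq_add] at h ⊢
  exact h

end Relations

/-! ### Action on the reference states -/

section Reference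

theorem siteOp_mulVec_ref (n : Fin N) {X : Matrix (Fin (c.twoS n + 1)) (Fin (c.twoS n + 1)) ℂ}
    {r : ℂ} (hX : ∀ i, X i 0 = if i = 0 then r else 0) :
    c.siteOp n X *ᵥ c.ref = r • c.ref := by
  rw [ref, mulVec_smul, smul_comm]
  congr 1
  ext h
  rw [mulVec_single_one, Matrix.col_apply, Pi.smul_apply, Pi.single_apply]
  simp only [siteOp, Matrix.of_apply, hX, smul_eq_mul, mul_ite, mul_one, mul_zero, ← ite_and]
  congr 1
  refine propext ⟨fun ⟨h1, h2⟩ => funext fun m => ?_, fun H => ?_⟩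
  · by_cases hm : m = n
    · rw [hm, h2]
    · exact h1 m hm
  · simp [H]

theorem ref_vecMul_siteOp (n : Fin N) {X : Matrix (Fin (c.twoS n + 1)) (Fin (c.twoS n + 1)) ℂ}
    {r : ℂ} (hX : ∀ i, X 0 i = if i = 0 then r else 0) :
    c.ref ᵥ* c.siteOp n X = r • c.ref := by
  rw [ref, smul_vecMul, smul_comm]
  congr 1
  ext h
  rw [single_one_vecMul, Matrix.row_apply, Pi.smul_apply, Pi.single_apply]
  simp only [siteOp, Matrix.of_apply, hX, smul_eq_mul, mul_ite, mul_one, mul_zero, ← ite_and]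
  congr 1
  refine propext ⟨fun ⟨h1, h2⟩ => funext fun m => ?_, fun H => ?_⟩
  · by_cases hm : m = n
    · rw [hm, h2]
    · exact (h1 m hm).symm
  · simp [H]

theorem lax_mulVec_ref (n : Fin N) (u : ℂ) :
    c.Lax n u 1 0 *ᵥ c.ref = 0 ∧
      c.Lax n u 1 1 *ᵥ c.ref = Complex.sinh (u - c.s n * c.η) • c.ref := by
  constructor
  · rw [← zero_smul ℂ c.ref]
    refine c.siteOp_mulVec_ref n fun i => ?_
    simp [Splus]
  · refine c.siteOp_mulVec_ref n fun i => ?_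
    rw [sinhSz, Matrix.diagonal_apply]
    split_ifs with h
    · subst h
      simp only [Fin.val_zero, Nat.cast_zero]
      congr 1
      ring
    · rfl

theorem ref_vecMul_lax (n : Fin N) (u : ℂ) :
    c.ref ᵥ* c.Lax n u 0 1 = 0 ∧
      c.ref ᵥ* c.Lax n u 1 1 = Complex.sinh (u - c.s n * c.η) • c.ref := by
  constructor
  · rw [← zero_smul ℂ c.ref]
    refine c.ref_vecMul_siteOp n fun i => ?_
    simp [Sminus]
  · refine c.ref_vecMul_siteOp n fun i => ?_
    rw [sinhSz, Matrix.diagonal_apply]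
    by_cases h : i = 0
    · subst h
      simp only [Fin.val_zero, Nat.cast_zero, if_true]
      congr 1
      ring
    · rw [if_neg (Ne.symm h), if_neg h]

theorem listMonodromy_mulVec_ref {l : List (Fin N)} (hl : l.Nodup) (u : ℂ) :
    c.listMonodromy l u 1 0 *ᵥ c.ref = 0 ∧ c.listMonodromy l u 1 1 *ᵥ c.ref =
      (l.map fun n => Complex.sinh (u - c.ξ n - c.s n * c.η)).prod • c.ref := by
  induction l with
  | nil => simp [listMonodromy_nil]
  | cons n l ih =>
    rw [List.nodup_cons] at hl
    obtain ⟨hC, hD⟩ := ih hl.2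
    obtain ⟨hc, hd⟩ := c.lax_mulVec_ref n (u - c.ξ n)
    have hcomm := c.entriesCommute_listMonodromy hl.1 (u - c.ξ n) u
    simp only [listMonodromy_cons, Matrix.mul_apply, Fin.sum_univ_two, add_mulVec]
    -- The lower left entry of the Lax operator is moved to the right, where it annihilates the
    -- reference vector.
    rw [(hcomm 1 0 0 0).eq, (hcomm 1 0 0 1).eq]
    simp only [← mulVec_mulVec, hC, hD, hc, hd, mulVec_zero, mulVec_smul, zero_add, List.map_cons,
      List.prod_cons, smul_smul, true_and]
    rw [mul_comm]

theorem ref_vecMul_listMonodromy {l : List (Fin N)} (hl : l.Nodup) (u : ℂ) :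
    c.ref ᵥ* c.listMonodromy l u 0 1 = 0 ∧ c.ref ᵥ* c.listMonodromy l u 1 1 =
      (l.map fun n => Complex.sinh (u - c.ξ n - c.s n * c.η)).prod • c.ref := by
  induction l with
  | nil => simp [listMonodromy_nil]
  | cons n l ih =>
    rw [List.nodup_cons] at hl
    obtain ⟨hB, hD⟩ := ih hl.2
    obtain ⟨hb, hd⟩ := c.ref_vecMul_lax n (u - c.ξ n)
    have hcomm := c.entriesCommute_listMonodromy hl.1 (u - c.ξ n) u
    simp only [listMonodromy_cons, Matrix.mul_apply, Fin.sum_univ_two, vecMul_add]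
    rw [(hcomm 0 0 0 1).eq, (hcomm 1 0 0 1).eq]
    simp only [← vecMul_vecMul, hB, hD, hb, hd, zero_vecMul, smul_vecMul, zero_add, List.map_cons,
      List.prod_cons, smul_smul, true_and]

theorem d_eq_list_prod (u : ℂ) : c.d u =
    ((List.finRange N).reverse.map fun n => Complex.sinh (u - c.ξ n - c.s n * c.η)).prod := by
  rw [d, Fin.prod_univ_def]
  exact (((List.reverse_perm _).map _).prod_eq).symm

theorem C_mulVec_ref (u : ℂ) : c.C u *ᵥ c.ref = 0 := by
  rw [C, monodromy_eq]
  exact (c.listMonodromy_mulVec_ref nodup_finRange_reverse u).1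

theorem D_mulVec_ref (u : ℂ) : c.D u *ᵥ c.ref = c.d u • c.ref := by
  rw [D, monodromy_eq, d_eq_list_prod]
  exact (c.listMonodromy_mulVec_ref nodup_finRange_reverse u).2

theorem ref_vecMul_B (u : ℂ) : c.ref ᵥ* c.B u = 0 := by
  rw [B, monodromy_eq]
  exact (c.ref_vecMul_listMonodromy nodup_finRange_reverse u).1

theorem ref_vecMul_D (u : ℂ) : c.ref ᵥ* c.D u = c.d u • c.ref := by
  rw [D, monodromy_eq, d_eq_list_prod]
  exact (c.ref_vecMul_listMonodromy nodup_finRange_reverse u).2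

end Reference

/-! ### Degrees of the monodromy entries -/

section TrigPoly

/-- The matrix elements of `F` are trigonometric polynomials. -/
def IsTrigPolyOp (n : ℕ) (F : ℂ → c.Op) : Prop := ∀ h k, IsTrigPoly n fun u => F u h k

variable {c}

theorem IsTrigPolyOp.add {n : ℕ} {F G : ℂ → c.Op} (hF : c.IsTrigPolyOp n F)
    (hG : c.IsTrigPolyOp n G) : c.IsTrigPolyOp n fun u => F u + G u :=
  fun h k => (hF h k).add (hG h k)

theorem IsTrigPolyOp.lift {n : ℕ} {F : ℂ → c.Op} (hF : c.IsTrigPolyOp n F) :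
    c.IsTrigPolyOp (n + 2) F :=
  fun h k => (hF h k).lift

theorem IsTrigPolyOp.mul {m n : ℕ} {F G : ℂ → c.Op} (hF : c.IsTrigPolyOp (m + 1) F)
    (hG : c.IsTrigPolyOp n G) : c.IsTrigPolyOp (m + n) fun u => F u * G u := by
  intro h k
  simp only [Matrix.mul_apply]
  exact IsTrigPoly.sum _ fun l _ => (hF h l).mul (hG l k)

theorem isTrigPolyOp_const (X : c.Op) : c.IsTrigPolyOp 1 fun _ => X :=
  fun _ _ => IsTrigPoly.const _

variable (c)

theorem isTrigPolyOp_sinhSz (n : Fin N) (η w : ℂ) :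
    c.IsTrigPolyOp 2 fun u => c.siteOp n (c.sinhSz n (u - w) η) := by
  intro h k
  simp only [siteOp, Matrix.of_apply, sinhSz, Matrix.diagonal_apply]
  split_ifs
  · simp only [sub_eq_add_neg _ w, add_assoc]
    exact IsTrigPoly.sinh_add_const _
  · exact IsTrigPoly.zero _
  · exact IsTrigPoly.zero _

/-- Off-diagonal Lax entries do not depend on u, so off-diagonal monodromy entries have one
frequency fewer, namely N for the full chain: this is why N nodes suffice for B and C. Products of
two off-diagonal entries fall two frequencies short and are lifted. -/
theorem isTrigPolyOp_listMonodromy (l : List (Fin N)) :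
    c.IsTrigPolyOp (l.length + 1) (fun u => c.listMonodromy l u 0 0) ∧
    c.IsTrigPolyOp l.length (fun u => c.listMonodromy l u 0 1) ∧
    c.IsTrigPolyOp l.length (fun u => c.listMonodromy l u 1 0) ∧
    c.IsTrigPolyOp (l.length + 1) (fun u => c.listMonodromy l u 1 1) := by
  induction l with
  | nil =>
    simp only [listMonodromy_nil, List.length_nil]
    exact ⟨isTrigPolyOp_const _, fun _ _ => IsTrigPoly.zero _, fun _ _ => IsTrigPoly.zero _,
      isTrigPolyOp_const _⟩
  | cons n l ih =>
    obtain ⟨hA, hB, hC, hD⟩ := ih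
    have ha : c.IsTrigPolyOp (1 + 1) fun u => c.Lax n (u - c.ξ n) 0 0 :=
      c.isTrigPolyOp_sinhSz n _ _
    have hb : c.IsTrigPolyOp (0 + 1) fun u => c.Lax n (u - c.ξ n) 0 1 := isTrigPolyOp_const _
    have hc : c.IsTrigPolyOp (0 + 1) fun u => c.Lax n (u - c.ξ n) 1 0 := isTrigPolyOp_const _
    have hd : c.IsTrigPolyOp (1 + 1) fun u => c.Lax n (u - c.ξ n) 1 1 :=
      c.isTrigPolyOp_sinhSz n _ _
    simp only [listMonodromy_cons, Matrix.mul_apply, Fin.sum_univ_two, List.length_cons]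
    refine ⟨?_, ?_, ?_, ?_⟩
    · have h1 := ha.mul hA
      have h2 := (hb.mul hC).lift
      rw [show 1 + (l.length + 1) = l.length + 1 + 1 by ring] at h1
      rw [show 0 + l.length + 2 = l.length + 1 + 1 by ring] at h2
      exact h1.add h2
    · have h1 := ha.mul hB
      have h2 := hb.mul hD
      rw [show 1 + l.length = l.length + 1 by ring] at h1
      rw [zero_add] at h2
      exact h1.add h2
    · have h1 := hc.mul hA
      have h2 := hd.mul hC
      rw [show 1 + l.length = l.length + 1 by ring] at h2
      rw [zero_add] at h1
      exact h1.add h2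
    · have h1 := (hc.mul hB).lift
      have h2 := hd.mul hD
      rw [show 1 + (l.length + 1) = l.length + 1 + 1 by ring] at h2
      rw [show 0 + l.length + 2 = l.length + 1 + 1 by ring] at h1
      exact h1.add h2

theorem isTrigPolyOp_monodromy :
    c.IsTrigPolyOp (N + 1) c.A ∧ c.IsTrigPolyOp N c.B ∧ c.IsTrigPolyOp N c.C ∧
      c.IsTrigPolyOp (N + 1) c.D := by
  have h := c.isTrigPolyOp_listMonodromy (List.finRange N).reverse
  simp only [← monodromy_eq, List.length_reverse, List.length_finRange] at h
  exact h

end TrigPoly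

end XXZChain

/-! ### Raising and lowering the entries of a tuple -/

section Shift

variable {N : ℕ}

theorem shiftUp_self (a : Fin N) (h : Fin N → ℕ) : shiftUp a h a = h a + 1 := by
  simp [shiftUp]

theorem shiftUp_of_ne {a b : Fin N} (hb : b ≠ a) (h : Fin N → ℕ) : shiftUp a h b = h b := by
  simp [shiftUp, hb]

theorem shiftDown_self (a : Fin N) (h : Fin N → ℕ) : shiftDown a h a = h a - 1 := by
  simp [shiftDown]

theorem shiftDown_of_ne {a b : Fin N} (hb : b ≠ a) (h : Fin N → ℕ) : shiftDown a h b = h b := by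
  simp [shiftDown, hb]

theorem shiftDown_shiftUp (a : Fin N) (h : Fin N → ℕ) : shiftDown a (shiftUp a h) = h := by
  simp [shiftDown, shiftUp]

theorem shiftUp_shiftDown {a : Fin N} {h : Fin N → ℕ} (ha : h a ≠ 0) :
    shiftUp a (shiftDown a h) = h := by
  simp [shiftDown, shiftUp, Nat.sub_add_cancel (Nat.pos_of_ne_zero ha)]

theorem shiftDown_le (a : Fin N) (h : Fin N → ℕ) : shiftDown a h ≤ h := by
  intro b
  by_cases hb : b = a
  · subst hb
    rw [shiftDown_self]
    exact Nat.sub_le _ _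
  · rw [shiftDown_of_ne hb]

theorem shiftUp_le {a : Fin N} {h m : Fin N → ℕ} (hm : h ≤ m) (ha : h a < m a) :
    shiftUp a h ≤ m := by
  intro b
  by_cases hb : b = a
  · subst hb
    rw [shiftUp_self]
    exact ha
  · rw [shiftUp_of_ne hb]
    exact hm b

/-- Induction on tuples bounded by `m`, by raising one entry at a time. -/
theorem shiftUp_induction (m : Fin N → ℕ) {p : (Fin N → ℕ) → Prop} (h0 : p 0)
    (hs : ∀ (h : Fin N → ℕ) (a : Fin N), h ≤ m → h a < m a → p h → p (shiftUp a h))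
    (h : Fin N → ℕ) (hm : h ≤ m) : p h := by
  induction hn : ∑ i, h i generalizing h with
  | zero =>
    have : h = 0 := by
      ext i
      exact Finset.sum_eq_zero_iff.1 hn i (Finset.mem_univ i)
    rwa [this]
  | succ n ih =>
    obtain ⟨a, -, ha⟩ := Finset.exists_ne_zero_of_sum_ne_zero (hn.trans_ne n.succ_ne_zero)
    rw [← shiftUp_shiftDown ha]
    have hle := (shiftDown_le a h).trans hm
    refine hs _ a hle ?_ (ih _ hle ?_)
    · have : h a ≤ m a := hm a
      rw [shiftDown_self]
      omega
    · rw [shiftDown, Finset.sum_update_of_mem (Finset.mem_univ a), ← Finset.erase_eq]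
      rw [← Finset.add_sum_erase _ _ (Finset.mem_univ a)] at hn
      omega

theorem list_prod_shiftUp {M : Type*} [Monoid M] {f : Fin N → ℕ → M}
    (hf : ∀ i j k l, Commute (f i j) (f k l)) (a : Fin N) (h : Fin N → ℕ) {l : List (Fin N)}
    (hl : l.Nodup) :
    (l.map fun n => ((List.range (shiftUp a h n)).map (f n)).prod).prod =
      (l.map fun n => ((List.range (h n)).map (f n)).prod).prod *
        if a ∈ l then f a (h a) else 1 := by
  induction l with
  | nil => simp
  | cons n l ih =>
    rw [List.nodup_cons] at hl
    rw [List.map_cons, List.prod_cons, List.map_cons, List.prod_cons, ih hl.2]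
    by_cases hn : n = a
    · subst hn
      rw [if_neg hl.1, if_pos List.mem_cons_self, shiftUp_self, List.range_succ, List.map_append,
        List.prod_append, List.map_singleton, List.prod_singleton, mul_one, mul_assoc, mul_assoc]
      congr 1
      refine (Commute.list_prod_right _ _ fun x hx => ?_).eq
      obtain ⟨k, -, rfl⟩ := List.mem_map.1 hx
      refine Commute.list_prod_right _ _ fun x hx => ?_
      obtain ⟨j, -, rfl⟩ := List.mem_map.1 hx
      exact hf _ _ _ _
    · rw [shiftUp_of_ne hn, mul_assoc]
      simp [Ne.symm hn]

end Shift

namespace XXZChain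

open Matrix YangBaxter Complex

variable {N : ℕ} (c : XXZChain N)

/-! ### Zeros and non-vanishing of `a`, `d` and the eigenvalue functions -/

section Parameters

theorem xi_succ (n : Fin N) (k : ℕ) : c.xi n (k + 1) = c.xi n k - c.η := by
  simp only [xi]
  push_cast
  ring

theorem xi_zero (n : Fin N) : c.xi n 0 = c.ξ n + c.s n * c.η := by
  simp [xi]

theorem xi_twoS (n : Fin N) : c.xi n (c.twoS n) = c.ξ n - c.s n * c.η := by
  simp only [xi, s]
  ring

theorem d_eq (u : ℂ) : c.d u = ∏ n, sinh (u - c.xi n 0) := by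
  simp only [d, xi_zero, sub_sub]

theorem a_eq (u : ℂ) : c.a u = ∏ n, sinh (u - c.xi n (c.twoS n)) := by
  simp only [a, xi_twoS, sub_sub_eq_add_sub, sub_add_eq_add_sub]

theorem eig_zero (u : ℂ) : c.eig 0 u = c.d u := by
  simp [eig, d_eq]

theorem eig_xi_self (h : Fin N → ℕ) (a : Fin N) : c.eig h (c.xi a (h a)) = 0 :=
  Finset.prod_eq_zero (Finset.mem_univ a) (by simp)

/-- The zero at ξ_a^(h_a) moves down by η. The form without division matches the coefficients of the
exchange relation and holds at every u. -/
theorem eig_shiftUp (h : Fin N → ℕ) (a : Fin N) (u : ℂ) :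
    sinh (u - c.xi a (h a)) * c.eig (shiftUp a h) u =
      sinh (u - c.xi a (h a) + c.η) * c.eig h u := by
  simp only [eig]
  rw [← Finset.mul_prod_erase _ _ (Finset.mem_univ a),
    ← Finset.mul_prod_erase (a := a) Finset.univ (fun n => sinh (u - c.xi n (h n)))
      (Finset.mem_univ a), shiftUp_self, xi_succ, sub_sub_eq_add_sub]
  rw [Finset.prod_congr rfl fun b hb => by rw [shiftUp_of_ne (Finset.ne_of_mem_erase hb)]]
  rw [show u + c.η - c.xi a (h a) = u - c.xi a (h a) + c.η by ring]
  ring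

variable {c}

theorem sinh_xi_sub_self_ne_zero (hη : c.Generic) (n : Fin N) {j k : ℕ} (hjk : j ≠ k) :
    sinh (c.xi n j - c.xi n k) ≠ 0 := by
  have key {j k : ℕ} (hjk : j < k) : sinh (c.xi n j - c.xi n k) ≠ 0 := by
    have e : c.xi n j - c.xi n k = ((k - j : ℕ) : ℂ) * c.η := by
      rw [Nat.cast_sub hjk.le, xi, xi]
      ring
    rw [e]
    exact hη.sinh_ne_zero (by omega)
  rcases lt_or_gt_of_ne hjk with h | h
  · exact key h
  · rw [← neg_sub, sinh_neg, neg_ne_zero]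
    exact key h

theorem sinh_xi_sub_ne_zero (hξ : c.Inhomogeneous) {m n : Fin N} (hmn : m ≠ n) {j k : ℕ}
    (hj : j ≤ c.twoS m) (hk : k ≤ c.twoS n) : sinh (c.xi m j - c.xi n k) ≠ 0 := by
  intro h
  have hexp : exp (2 * (c.xi m j - c.xi n k)) = 1 := by
    have h1 : exp (c.xi m j - c.xi n k) = exp (-(c.xi m j - c.xi n k)) := by
      rw [Complex.sinh] at h
      linear_combination 2 * h
    rw [two_mul, exp_add]
    nth_rw 2 [h1]
    rw [← exp_add]
    simp
  obtain ⟨z, hz⟩ := exp_eq_one_iff.1 hexp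
  have hmem : c.xi m j ∈ c.Xi m ∩ c.Xi n := by
    -- `Xi` counts upwards from -s and `xi` downwards from s, hence the complementary indices; z is
    -- the multiple of iπ by which the two points differ.
    refine ⟨⟨c.twoS m - j, Nat.sub_le _ _, 0, ?_⟩, ⟨c.twoS n - k, Nat.sub_le _ _, z, ?_⟩⟩
    · rw [Nat.cast_sub hj, xi, s]
      push_cast
      ring
    · have : c.xi m j = c.xi n k + z * (Real.pi * I) := by linear_combination hz / 2
      rw [this, Nat.cast_sub hk, xi, s]
      ring
  rw [hξ m n hmn] at hmem
  exact hmem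

/-- The eigenvalue function `c.eig k` does not vanish at the zeros of the others. -/
theorem eig_xi_ne_zero (hη : c.Generic) (hξ : c.Inhomogeneous) {k : Fin N → ℕ} {a : Fin N} {j : ℕ}
    (hj : j ≤ c.twoS a) (hk : ∀ b, b ≠ a → k b ≤ c.twoS b) (hjk : j ≠ k a) :
    c.eig k (c.xi a j) ≠ 0 := by
  refine Finset.prod_ne_zero_iff.2 fun b _ => ?_
  by_cases hb : b = a
  · subst hb
    exact sinh_xi_sub_self_ne_zero hη _ hjk
  · exact sinh_xi_sub_ne_zero hξ (Ne.symm hb) hj (hk b hb)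

theorem d_xi_zero (a : Fin N) : c.d (c.xi a 0) = 0 := by
  rw [← eig_zero]
  exact c.eig_xi_self 0 a

theorem a_xi_twoS (a : Fin N) : c.a (c.xi a (c.twoS a)) = 0 := by
  rw [a_eq]
  exact c.eig_xi_self c.twoS a

theorem d_xi_ne_zero (hη : c.Generic) (hξ : c.Inhomogeneous) {a : Fin N} {k : ℕ}
    (hk : k < c.twoS a) : c.d (c.xi a (k + 1)) ≠ 0 := by
  rw [← eig_zero]
  exact eig_xi_ne_zero hη hξ hk (fun _ _ => Nat.zero_le _) k.succ_ne_zero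

theorem a_xi_ne_zero (hη : c.Generic) (hξ : c.Inhomogeneous) {a : Fin N} {k : ℕ}
    (hk : k < c.twoS a) : c.a (c.xi a k) ≠ 0 := by
  rw [a_eq]
  exact eig_xi_ne_zero hη hξ hk.le (fun _ _ => le_rfl) hk.ne

theorem vdm_ne_zero (hξ : c.Inhomogeneous) {h : Fin N → ℕ} (hh : h ≤ c.twoS) : c.vdm h ≠ 0 :=
  Finset.prod_ne_zero_iff.2 fun i _ => Finset.prod_ne_zero_iff.2 fun j hj =>
    sinh_xi_sub_ne_zero hξ (Finset.mem_Ioi.1 hj).ne' (hh j) (hh i)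

end Parameters

/-! ### Trigonometric Vandermonde products -/

section Vandermonde

/-- The dependence of a trigonometric Vandermonde product on one of its variables. -/
theorem vandermonde_update (x : Fin N → ℂ) (a : Fin N) : ∃ r : ℂ, ∀ y : ℂ,
    (∏ i, ∏ j ∈ Finset.Ioi i, sinh (Function.update x a y j - Function.update x a y i)) =
      r * ∏ b ∈ Finset.univ.erase a, sinh (y - x b) := by
  refine ⟨∏ i ∈ Finset.univ.erase a,
    (if a < i then -1 else 1) * ∏ j ∈ (Finset.Ioi i).erase a, sinh (x j - x i), fun y => ?_⟩
  have hIoi : Finset.Ioi a = (Finset.univ.erase a).filter (a < ·) := by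
    ext i
    simp only [Finset.mem_Ioi, Finset.mem_filter, Finset.mem_erase, Finset.mem_univ, and_true]
    exact ⟨fun h => ⟨h.ne', h⟩, fun h => h.2⟩
  rw [← Finset.mul_prod_erase _ _ (Finset.mem_univ a)]
  nth_rw 1 [hIoi]
  rw [Finset.prod_filter, ← Finset.prod_mul_distrib, ← Finset.prod_mul_distrib]
  refine Finset.prod_congr rfl fun i hi => ?_
  have hia := Finset.ne_of_mem_erase hi
  rw [Function.update_self, Function.update_of_ne hia]
  have hcongr : ∏ j ∈ (Finset.Ioi i).erase a, sinh (Function.update x a y j - x i) =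
      ∏ j ∈ (Finset.Ioi i).erase a, sinh (x j - x i) :=
    Finset.prod_congr rfl fun j hj => by rw [Function.update_of_ne (Finset.ne_of_mem_erase hj)]
  by_cases hlt : a < i
  · have : a ∉ Finset.Ioi i := by simp [hlt.le]
    rw [if_pos hlt, if_pos hlt, ← hcongr, Finset.erase_eq_of_notMem this, ← neg_sub y, sinh_neg]
    ring
  · have hlt' : i < a := lt_of_le_of_ne (not_lt.1 hlt) hia
    rw [if_neg hlt, if_neg hlt, ← Finset.mul_prod_erase _ _ (Finset.mem_Ioi.2 hlt'), hcongr,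
      Function.update_self]
    ring

/-- The two products differ only in the variable at `a`, so the constant r of `vandermonde_update`
is common. This is the ratio needed in the recursion for the diagonal pairings. -/
theorem vdm_shiftUp (h : Fin N → ℕ) (a : Fin N) :
    c.vdm h * ∏ b ∈ Finset.univ.erase a, sinh (c.xi a (h a + 1) - c.xi b (h b)) =
      c.vdm (shiftUp a h) * ∏ b ∈ Finset.univ.erase a, sinh (c.xi a (h a) - c.xi b (h b)) := by
  obtain ⟨r, hr⟩ := vandermonde_update (fun b => c.xi b (h b)) a
  have h1 : c.vdm h =
      r * ∏ b ∈ Finset.univ.erase a, sinh (c.xi a (h a) - c.xi b (h b)) := by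
    rw [← hr, Function.update_eq_self a fun b => c.xi b (h b)]
    rfl
  have h2 : c.vdm (shiftUp a h) =
      r * ∏ b ∈ Finset.univ.erase a, sinh (c.xi a (h a + 1) - c.xi b (h b)) := by
    rw [← hr]
    have : (fun b => c.xi b (shiftUp a h b)) =
        Function.update (fun b => c.xi b (h b)) a (c.xi a (h a + 1)) := by
      ext b
      by_cases hb : b = a
      · subst hb; simp [shiftUp_self]
      · simp [shiftUp_of_ne hb, hb]
    rw [← this]
    rfl
  rw [h1, h2]
  ring

end Vandermonde

end XXZChain

namespace XXZChain

open Matrix YangBaxter Complex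

variable {N : ℕ} {c : XXZChain N}

section Continuity

theorem isTrigPoly_vecMul_apply {n : ℕ} {F : ℂ → c.Op} (hF : c.IsTrigPolyOp n F) (v : c.State)
    (i : c.Config) : IsTrigPoly n fun u => (v ᵥ* F u) i := by
  simp only [vecMul, dotProduct]
  exact IsTrigPoly.sum _ fun j _ => (hF j i).const_mul _

theorem isTrigPoly_mulVec_apply {n : ℕ} {F : ℂ → c.Op} (hF : c.IsTrigPolyOp n F) (v : c.State)
    (i : c.Config) : IsTrigPoly n fun u => (F u *ᵥ v) i := by
  simp only [mulVec, dotProduct]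
  exact IsTrigPoly.sum _ fun j _ => (hF i j).mul_const _

theorem continuous_eig (h : Fin N → ℕ) : Continuous (c.eig h) := by
  unfold eig
  fun_prop

/-- An equation between vector functions may be checked after multiplication by `sinh (u - w)`. -/
theorem eq_of_sinh_smul_eq {F G : ℂ → c.State} (hF : ∀ i, Continuous fun u => F u i)
    (hG : ∀ i, Continuous fun u => G u i) (w : ℂ)
    (h : ∀ u, sinh (u - w) • F u = sinh (u - w) • G u) (u : ℂ) : F u = G u := by
  ext i
  have := eq_zero_of_mul_sinh_eq_zero (f := fun u => F u i - G u i) ((hF i).sub (hG i)) w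
    fun u => ?_
  · exact sub_eq_zero.1 (congrFun this u)
  · have := congrFun (h u) i
    simp only [Pi.smul_apply, smul_eq_mul] at this
    linear_combination this

end Continuity

/-! ### Bras and kets as eigenstates of `D` -/

section States

theorem bra_zero : c.bra 0 = c.ref := by
  simp [bra]

theorem ket_zero : c.ket 0 = c.ref := by
  simp [ket]

theorem bra_shiftUp (hη : c.Generic) (hx : c.RootsLadder) (h : Fin N → ℕ) (a : Fin N) :
    c.bra (shiftUp a h) =
      (c.d (c.xi a (h a + 1)))⁻¹ • (c.bra h ᵥ* c.C (c.xi a (h a))) := by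
  rw [bra, list_prod_shiftUp (f := fun n k => (c.d (c.xi n (k + 1)))⁻¹ • c.C (c.xi n k))
    (fun i j k l => ((C_commute hη hx _ _).smul_left _).smul_right _) a h (List.nodup_finRange N),
    if_pos (List.mem_finRange a), ← vecMul_vecMul, vecMul_smul]
  rfl

theorem ket_shiftUp (hη : c.Generic) (hx : c.RootsLadder) (h : Fin N → ℕ) (a : Fin N) :
    c.ket (shiftUp a h) = -((c.a (c.xi a (h a)))⁻¹ • (c.B (c.xi a (h a)) *ᵥ c.ket h)) := by
  have hcomm (i : Fin N) (j : ℕ) (k : Fin N) (l : ℕ) :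
      Commute (-((c.a (c.xi i j))⁻¹ • c.B (c.xi i j))) (-((c.a (c.xi k l))⁻¹ • c.B (c.xi k l))) :=
    (((B_commute hη hx _ _).smul_left _).smul_right _).neg_left.neg_right
  rw [ket, list_prod_shiftUp (f := fun n k => -((c.a (c.xi n k))⁻¹ • c.B (c.xi n k)))
    hcomm a h (List.nodup_finRange N), if_pos (List.mem_finRange a)]
  -- The extra factor comes out next to the reference vector; it is moved to the left so that it
  -- acts on the completed ket.
  have : Commute ((List.finRange N).map fun n =>
      ((List.range (h n)).map fun k => -((c.a (c.xi n k))⁻¹ • c.B (c.xi n k))).prod).prod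
      (-((c.a (c.xi a (h a)))⁻¹ • c.B (c.xi a (h a)))) := by
    refine Commute.list_prod_left _ _ fun x hx => ?_
    obtain ⟨n, -, rfl⟩ := List.mem_map.1 hx
    refine Commute.list_prod_left _ _ fun x hx => ?_
    obtain ⟨k, -, rfl⟩ := List.mem_map.1 hx
    exact hcomm _ _ _ _
  rw [this.eq, ← mulVec_mulVec, neg_mulVec, smul_mulVec]
  rfl

end States

section Eigenstates

/-- With v = ξ_a^(h_a), the term w D(v) C(u) of the exchange relation is zero, and the remaining
factor sinh (u - v) is cancelled by continuity. No bound on h is imposed, so the case h_a = 2s_a is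
included and is used for the upper boundary. -/
theorem vecMul_C_vecMul_D (hη : c.Generic) (hx : c.RootsLadder) {h : Fin N → ℕ} {w : c.State}
    (hw : ∀ u, w ᵥ* c.D u = c.eig h u • w) (a : Fin N) (u : ℂ) :
    w ᵥ* c.C (c.xi a (h a)) ᵥ* c.D u = c.eig (shiftUp a h) u • (w ᵥ* c.C (c.xi a (h a))) := by
  refine eq_of_sinh_smul_eq (F := fun u => w ᵥ* c.C (c.xi a (h a)) ᵥ* c.D u)
    (G := fun u => c.eig (shiftUp a h) u • (w ᵥ* c.C (c.xi a (h a))))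
    (fun i => (isTrigPoly_vecMul_apply c.isTrigPolyOp_monodromy.2.2.2 _ i).continuous)
    (fun i => (continuous_eig _).mul continuous_const) (c.xi a (h a)) (fun u => ?_) u
  have hex := congrArg (fun M => w ᵥ* M) (D_C_exchange hη hx u (c.xi a (h a)))
  simp only [vecMul_smul, vecMul_add, ← vecMul_vecMul, hw, eig_xi_self, zero_smul, zero_vecMul,
    smul_zero, add_zero, smul_vecMul] at hex
  rw [← hex, smul_smul, smul_smul, eig_shiftUp]

theorem D_mulVec_B_mulVec (hη : c.Generic) (hx : c.RootsLadder) {h : Fin N → ℕ} {w : c.State}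
    (hw : ∀ u, c.D u *ᵥ w = c.eig h u • w) (a : Fin N) (u : ℂ) :
    c.D u *ᵥ c.B (c.xi a (h a)) *ᵥ w = c.eig (shiftUp a h) u • (c.B (c.xi a (h a)) *ᵥ w) := by
  refine eq_of_sinh_smul_eq (F := fun u => c.D u *ᵥ c.B (c.xi a (h a)) *ᵥ w)
    (G := fun u => c.eig (shiftUp a h) u • (c.B (c.xi a (h a)) *ᵥ w))
    (fun i => (isTrigPoly_mulVec_apply c.isTrigPolyOp_monodromy.2.2.2 _ i).continuous)
    (fun i => (continuous_eig _).mul continuous_const) (c.xi a (h a)) (fun u => ?_) u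
  have hex := congrArg (fun M => M *ᵥ w) (D_B_exchange hη hx u (c.xi a (h a)))
  simp only [smul_mulVec, add_mulVec, ← mulVec_mulVec, hw, eig_xi_self, zero_smul, mulVec_zero,
    smul_zero, add_zero, mulVec_smul] at hex
  rw [hex, smul_smul, smul_smul, eig_shiftUp]

theorem bra_vecMul_D (hη : c.Generic) (hx : c.RootsLadder) (h : Fin N → ℕ) (u : ℂ) :
    c.bra h ᵥ* c.D u = c.eig h u • c.bra h := by
  refine shiftUp_induction h (p := fun h => ∀ u, c.bra h ᵥ* c.D u = c.eig h u • c.bra h)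
    (fun u => ?_) (fun h a _ _ ih u => ?_) h le_rfl u
  · rw [bra_zero, eig_zero, ref_vecMul_D]
  · rw [bra_shiftUp hη hx, smul_vecMul, vecMul_C_vecMul_D hη hx ih, smul_comm]

theorem D_mulVec_ket (hη : c.Generic) (hx : c.RootsLadder) (h : Fin N → ℕ) (u : ℂ) :
    c.D u *ᵥ c.ket h = c.eig h u • c.ket h := by
  refine shiftUp_induction h (p := fun h => ∀ u, c.D u *ᵥ c.ket h = c.eig h u • c.ket h)
    (fun u => ?_) (fun h a _ _ ih u => ?_) h le_rfl u
  · rw [ket_zero, eig_zero, D_mulVec_ref]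
  · rw [ket_shiftUp hη hx, mulVec_neg, mulVec_smul, D_mulVec_B_mulVec hη hx ih, smul_neg,
      smul_comm]

end Eigenstates

section Interpolation

theorem vecMul_eq_interp (hξ : c.Inhomogeneous) {F : ℂ → c.Op} (hF : c.IsTrigPolyOp N F)
    (v : c.State) {h : Fin N → ℕ} (hh : h ≤ c.twoS) (u : ℂ) :
    v ᵥ* F u = ∑ a, c.interp h a u • (v ᵥ* F (c.xi a (h a))) := by
  ext i
  rw [(isTrigPoly_vecMul_apply hF v i).eq_interpolation (x := fun a => c.xi a (h a))
    (fun a b hab => sinh_xi_sub_ne_zero hξ hab (hh a) (hh b)) u]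
  simp [Finset.sum_apply, interp]

theorem mulVec_eq_interp (hξ : c.Inhomogeneous) {F : ℂ → c.Op} (hF : c.IsTrigPolyOp N F)
    (v : c.State) {h : Fin N → ℕ} (hh : h ≤ c.twoS) (u : ℂ) :
    F u *ᵥ v = ∑ a, c.interp h a u • (F (c.xi a (h a)) *ᵥ v) := by
  ext i
  rw [(isTrigPoly_mulVec_apply hF v i).eq_interpolation (x := fun a => c.xi a (h a))
    (fun a b hab => sinh_xi_sub_ne_zero hξ hab (hh a) (hh b)) u]
  simp [Finset.sum_apply, interp]

end Interpolation

/-! ### Lowering by the quantum determinant -/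

section Lowering

/-- C(ξ_a^(0)) kills the reference vector and commutes past each B(ξ_b^(h_b)) with b ≠ a: both
correction terms contain a D that kills the ket. -/
theorem C_mulVec_ket_eq_zero (hη : c.Generic) (hx : c.RootsLadder) (hξ : c.Inhomogeneous)
    {h : Fin N → ℕ} (hh : h ≤ c.twoS) {a : Fin N} (ha : h a = 0) :
    c.C (c.xi a 0) *ᵥ c.ket h = 0 := by
  refine shiftUp_induction c.twoS (p := fun h => h a = 0 → c.C (c.xi a 0) *ᵥ c.ket h = 0)
    (fun _ => ?_) (fun h b hh hb ih ha => ?_) h hh ha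
  · rw [ket_zero, C_mulVec_ref]
  · by_cases hab : b = a
    · subst hab
      simp [shiftUp_self] at ha
    rw [shiftUp_of_ne (Ne.symm hab)] at ha
    have hs := sinh_xi_sub_ne_zero hξ (Ne.symm hab) (Nat.zero_le (c.twoS a)) hb.le
    have hDa : c.D (c.xi a 0) *ᵥ c.ket h = 0 := by
      rw [D_mulVec_ket hη hx, ← ha, eig_xi_self, zero_smul]
    have hDb : c.D (c.xi b (h b)) *ᵥ c.ket h = 0 := by
      rw [D_mulVec_ket hη hx, eig_xi_self, zero_smul]
    have hex := congrArg (fun M => M *ᵥ c.ket h) (C_B_exchange hη hx (c.xi a 0) (c.xi b (h b)))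
    simp only [add_mulVec, smul_mulVec, ← mulVec_mulVec, hDa, hDb, ih ha, mulVec_zero, smul_zero,
      add_zero] at hex
    rw [ket_shiftUp hη hx, mulVec_neg, mulVec_smul, (smul_eq_zero.1 hex).resolve_left hs,
      smul_zero, neg_zero]

/-- Writing h = T_a^+ k, the C here sits at the argument of the last B shifted by -η. D kills |k⟩
there, so the quantum determinant turns the product C B into the scalar -a d. -/
theorem C_xi_mulVec_ket (hη : c.Generic) (hx : c.RootsLadder) (hξ : c.Inhomogeneous)
    {h : Fin N → ℕ} (hh : h ≤ c.twoS) (a : Fin N) :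
    c.C (c.xi a (h a)) *ᵥ c.ket h = c.d (c.xi a (h a)) • c.ket (shiftDown a h) := by
  by_cases ha : h a = 0
  · rw [ha, C_mulVec_ket_eq_zero hη hx hξ hh ha, d_xi_zero, zero_smul]
  · obtain ⟨k, hk, rfl⟩ : ∃ k, k a < c.twoS a ∧ h = shiftUp a k := by
      refine ⟨shiftDown a h, ?_, (shiftUp_shiftDown ha).symm⟩
      have : h a ≤ c.twoS a := hh a
      rw [shiftDown_self]
      omega
    rw [shiftDown_shiftUp, shiftUp_self, ket_shiftUp hη hx, xi_succ]
    have h0 := a_xi_ne_zero hη hξ hk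
    have hq := congrArg (fun M => M *ᵥ c.ket k) (qdet_A_D_shifted hη hx (c.xi a (k a)))
    simp only [sub_mulVec, smul_mulVec, one_mulVec, ← mulVec_mulVec, D_mulVec_ket hη hx,
      eig_xi_self, zero_smul, mulVec_zero, zero_sub] at hq
    rw [mulVec_neg, mulVec_smul, ← smul_neg, hq, smul_smul, inv_mul_cancel_left₀ h0]

theorem bra_vecMul_B_eq_zero (hη : c.Generic) (hx : c.RootsLadder) (hξ : c.Inhomogeneous)
    {h : Fin N → ℕ} (hh : h ≤ c.twoS) {a : Fin N} (ha : h a = 0) :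
    c.bra h ᵥ* c.B (c.xi a 0) = 0 := by
  refine shiftUp_induction c.twoS (p := fun h => h a = 0 → c.bra h ᵥ* c.B (c.xi a 0) = 0)
    (fun _ => ?_) (fun h b hh hb ih ha => ?_) h hh ha
  · rw [bra_zero, ref_vecMul_B]
  · by_cases hab : b = a
    · subst hab
      simp [shiftUp_self] at ha
    rw [shiftUp_of_ne (Ne.symm hab)] at ha
    have hs := sinh_xi_sub_ne_zero hξ (Ne.symm hab) (Nat.zero_le (c.twoS a)) hb.le
    have hDa : c.bra h ᵥ* c.D (c.xi a 0) = 0 := by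
      rw [bra_vecMul_D hη hx, ← ha, eig_xi_self, zero_smul]
    have hDb : c.bra h ᵥ* c.D (c.xi b (h b)) = 0 := by
      rw [bra_vecMul_D hη hx, eig_xi_self, zero_smul]
    have hex := congrArg (fun M => c.bra h ᵥ* M) (B_C_exchange hη hx (c.xi a 0) (c.xi b (h b)))
    simp only [vecMul_add, vecMul_smul, ← vecMul_vecMul, hDa, hDb, ih ha, zero_vecMul, smul_zero,
      add_zero] at hex
    rw [bra_shiftUp hη hx, smul_vecMul, (smul_eq_zero.1 hex.symm).resolve_left hs, smul_zero]

theorem bra_vecMul_B_xi (hη : c.Generic) (hx : c.RootsLadder) (hξ : c.Inhomogeneous)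
    {h : Fin N → ℕ} (hh : h ≤ c.twoS) (a : Fin N) :
    c.bra h ᵥ* c.B (c.xi a (h a)) =
      -(((if h a = 0 then 0 else 1) * c.a (c.xi a (h a - 1))) • c.bra (shiftDown a h)) := by
  by_cases ha : h a = 0
  · rw [if_pos ha, ha, bra_vecMul_B_eq_zero hη hx hξ hh ha, zero_mul, zero_smul, neg_zero]
  · rw [if_neg ha, one_mul]
    obtain ⟨k, hk, rfl⟩ : ∃ k, k a < c.twoS a ∧ h = shiftUp a k := by
      refine ⟨shiftDown a h, ?_, (shiftUp_shiftDown ha).symm⟩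
      have : h a ≤ c.twoS a := hh a
      rw [shiftDown_self]
      omega
    have h0 := d_xi_ne_zero hη hξ hk
    rw [shiftDown_shiftUp, shiftUp_self, bra_shiftUp hη hx, Nat.add_sub_cancel]
    rw [xi_succ] at h0 ⊢
    have hq := congrArg (fun M => c.bra k ᵥ* M) (qdet_D_A hη hx (c.xi a (k a)))
    simp only [vecMul_sub, vecMul_smul, vecMul_one, ← vecMul_vecMul, bra_vecMul_D hη hx,
      eig_xi_self, zero_smul, zero_vecMul, zero_sub] at hq
    rw [smul_vecMul, ← neg_inj, neg_neg, ← smul_neg, hq, smul_smul, mul_comm (c.a _),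
      inv_mul_cancel_left₀ h0]

end Lowering

/-! ### The pairing of bras and kets -/

section Pairing

/-- D at ξ_a^(h_a) kills the bra but multiplies the ket by a nonzero number. -/
theorem bra_dotProduct_ket_of_ne (hη : c.Generic) (hx : c.RootsLadder) (hξ : c.Inhomogeneous)
    {h k : Fin N → ℕ} (hh : h ≤ c.twoS) (hk : k ≤ c.twoS) (hne : h ≠ k) :
    c.bra h ⬝ᵥ c.ket k = 0 := by
  obtain ⟨a, ha⟩ := Function.ne_iff.1 hne
  have h1 := dotProduct_mulVec (c.bra h) (c.D (c.xi a (h a))) (c.ket k)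
  rw [D_mulVec_ket hη hx, bra_vecMul_D hη hx, eig_xi_self, zero_smul, zero_dotProduct,
    dotProduct_smul, smul_eq_zero] at h1
  exact h1.resolve_left (eig_xi_ne_zero hη hξ (hh a) (fun b _ => hk b) ha)

/-- The C that raised the bra is applied to the ket, interpolated at the nodes of the raised tuple.
Each term lowers one entry, and by orthogonality only the lowering of `a` pairs with ⟨h|. -/
theorem bra_dotProduct_ket_shiftUp (hη : c.Generic) (hx : c.RootsLadder) (hξ : c.Inhomogeneous)
    {h : Fin N → ℕ} (hh : h ≤ c.twoS) {a : Fin N} (ha : h a < c.twoS a) :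
    c.bra (shiftUp a h) ⬝ᵥ c.ket (shiftUp a h) =
      c.interp (shiftUp a h) a (c.xi a (h a)) * (c.bra h ⬝ᵥ c.ket h) := by
  have hup := shiftUp_le hh ha
  rw [bra_shiftUp hη hx, smul_dotProduct, ← dotProduct_mulVec,
    mulVec_eq_interp hξ c.isTrigPolyOp_monodromy.2.2.1 _ hup, dotProduct_sum,
    Finset.sum_eq_single a]
  · rw [C_xi_mulVec_ket hη hx hξ hup, shiftDown_shiftUp, shiftUp_self, dotProduct_smul,
      dotProduct_smul]
    simp only [smul_eq_mul]
    have := d_xi_ne_zero hη hξ ha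
    field_simp
  · intro b _ hb
    rw [C_xi_mulVec_ket hη hx hξ hup, dotProduct_smul, dotProduct_smul,
      bra_dotProduct_ket_of_ne hη hx hξ hh ((shiftDown_le _ _).trans hup), smul_zero, smul_zero]
    intro he
    have := congrFun he a
    rw [shiftDown_of_ne (Ne.symm hb), shiftUp_self] at this
    omega
  · simp

theorem bra_dotProduct_ket_self_mul_vdm (hη : c.Generic) (hx : c.RootsLadder) (hν : c.RootNorm)
    (hξ : c.Inhomogeneous) {h : Fin N → ℕ} (hh : h ≤ c.twoS) :
    (c.bra h ⬝ᵥ c.ket h) * c.vdm h = 1 := by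
  refine shiftUp_induction c.twoS (p := fun h => (c.bra h ⬝ᵥ c.ket h) * c.vdm h = 1)
    ?_ (fun h a hh ha ih => ?_) h hh
  · have h0 := vdm_ne_zero hξ (h := 0) (fun _ => Nat.zero_le _)
    rw [bra_zero, ket_zero, ← hν] at *
    have hν0 : c.ν ≠ 0 := by
      rintro h
      simp [h] at h0
    simp [ref]
    field_simp
  · rw [bra_dotProduct_ket_shiftUp hη hx hξ hh ha, interp, Finset.prod_div_distrib]
    have hup := shiftUp_le hh ha
    have e1 : ∏ b ∈ Finset.univ.erase a, sinh (c.xi a (h a) - c.xi b (shiftUp a h b)) =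
        ∏ b ∈ Finset.univ.erase a, sinh (c.xi a (h a) - c.xi b (h b)) :=
      Finset.prod_congr rfl fun b hb => by rw [shiftUp_of_ne (Finset.ne_of_mem_erase hb)]
    have e2 : ∏ b ∈ Finset.univ.erase a,
        sinh (c.xi a (shiftUp a h a) - c.xi b (shiftUp a h b)) =
        ∏ b ∈ Finset.univ.erase a, sinh (c.xi a (h a + 1) - c.xi b (h b)) :=
      Finset.prod_congr rfl fun b hb => by
        rw [shiftUp_self, shiftUp_of_ne (Finset.ne_of_mem_erase hb)]
    have hne : ∏ b ∈ Finset.univ.erase a, sinh (c.xi a (h a + 1) - c.xi b (h b)) ≠ 0 :=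
      Finset.prod_ne_zero_iff.2 fun b hb =>
        sinh_xi_sub_ne_zero hξ (Finset.ne_of_mem_erase hb).symm ha (hh b)
    rw [e1, e2, div_mul_eq_mul_div, div_mul_eq_mul_div, div_eq_one_iff_eq hne]
    linear_combination (-(c.bra h ⬝ᵥ c.ket h)) * c.vdm_shiftUp h a +
      (∏ b ∈ Finset.univ.erase a, sinh (c.xi a (h a + 1) - c.xi b (h b))) * ih

end Pairing

end XXZChain

namespace XXZChain

open Matrix YangBaxter Complex

variable {N : ℕ} {c : XXZChain N}

/-! ### Bases and the decomposition of the identity -/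

section Bases

theorem Config.toNat_le (h : c.Config) : h.toNat ≤ c.twoS :=
  fun n => Nat.le_of_lt_succ (h n).isLt

theorem Config.toNat_injective : Function.Injective (Config.toNat (c := c)) :=
  fun _ _ h => funext fun n => Fin.ext (congrFun h n)

theorem bra_dotProduct_ket (hη : c.Generic) (hx : c.RootsLadder) (hν : c.RootNorm)
    (hξ : c.Inhomogeneous) (h k : c.Config) :
    c.bra h.toNat ⬝ᵥ c.ket k.toNat = if h = k then (c.vdm h.toNat)⁻¹ else 0 := by
  split_ifs with hhk
  · subst hhk
    exact eq_inv_of_mul_eq_one_left (bra_dotProduct_ket_self_mul_vdm hη hx hν hξ h.toNat_le)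
  · exact bra_dotProduct_ket_of_ne hη hx hξ h.toNat_le k.toNat_le
      fun e => hhk (Config.toNat_injective e)

theorem braMatrix_mul_ketMatrix (hη : c.Generic) (hx : c.RootsLadder) (hν : c.RootNorm)
    (hξ : c.Inhomogeneous) :
    (Matrix.of fun h : c.Config => c.bra h.toNat) *
      (Matrix.of fun (i h : c.Config) => c.vdm h.toNat * c.ket h.toNat i) = 1 := by
  ext h k
  have := bra_dotProduct_ket hη hx hν hξ h k
  rw [dotProduct] at this
  simp only [Matrix.mul_apply, Matrix.of_apply, mul_left_comm _ (c.vdm k.toNat)]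
  rw [← Finset.mul_sum, this, Matrix.one_apply]
  split_ifs with hhk
  · subst hhk
    exact mul_inv_cancel₀ (vdm_ne_zero hξ h.toNat_le)
  · exact mul_zero _

/-- The pairing says that the bra matrix times the rescaled ket matrix is the identity; for square
matrices the reverse product is then the identity too. -/
theorem one_eq_sum_vecMulVec (hη : c.Generic) (hx : c.RootsLadder) (hν : c.RootNorm)
    (hξ : c.Inhomogeneous) :
    (1 : c.Op) =
      ∑ h : c.Config, c.vdm h.toNat • Matrix.vecMulVec (c.ket h.toNat) (c.bra h.toNat) := by
  rw [← mul_eq_one_comm.1 (braMatrix_mul_ketMatrix hη hx hν hξ)]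
  ext i j
  simp [Matrix.mul_apply, Matrix.sum_apply, vecMulVec_apply, mul_assoc]

theorem eq_sum_ket (hη : c.Generic) (hx : c.RootsLadder) (hν : c.RootNorm)
    (hξ : c.Inhomogeneous) (v : c.State) :
    v = ∑ h : c.Config, (c.vdm h.toNat * (c.bra h.toNat ⬝ᵥ v)) • c.ket h.toNat := by
  conv_lhs => rw [← one_mulVec v, one_eq_sum_vecMulVec hη hx hν hξ, sum_mulVec]
  refine Finset.sum_congr rfl fun h _ => ?_
  ext i
  simp [smul_mulVec, vecMulVec_mulVec]
  ring

theorem eq_sum_bra (hη : c.Generic) (hx : c.RootsLadder) (hν : c.RootNorm)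
    (hξ : c.Inhomogeneous) (v : c.State) :
    v = ∑ h : c.Config, (c.vdm h.toNat * (v ⬝ᵥ c.ket h.toNat)) • c.bra h.toNat := by
  conv_lhs => rw [← vecMul_one v, one_eq_sum_vecMulVec hη hx hν hξ, vecMul_sum]
  refine Finset.sum_congr rfl fun h _ => ?_
  rw [vecMul_smul, vecMul_vecMulVec, smul_smul]

theorem isBasisFamily_of_eq_sum {v : c.Config → c.State} {f : c.State → c.Config → ℂ}
    (h : ∀ w, w = ∑ h, f w h • v h) : IsBasisFamily v := by
  have hspan : ⊤ ≤ Submodule.span ℂ (Set.range v) := by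
    rintro w -
    rw [h w]
    exact Submodule.sum_mem _ fun k _ =>
      Submodule.smul_mem _ _ (Submodule.subset_span (Set.mem_range_self k))
  exact ⟨linearIndependent_of_top_le_span_of_card_eq_finrank hspan (by simp), top_le_iff.1 hspan⟩

theorem isBasisFamily_bra (hη : c.Generic) (hx : c.RootsLadder) (hν : c.RootNorm)
    (hξ : c.Inhomogeneous) : IsBasisFamily fun h : c.Config => c.bra h.toNat :=
  isBasisFamily_of_eq_sum (eq_sum_bra hη hx hν hξ)

theorem isBasisFamily_ket (hη : c.Generic) (hx : c.RootsLadder) (hν : c.RootNorm)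
    (hξ : c.Inhomogeneous) : IsBasisFamily fun h : c.Config => c.ket h.toNat :=
  isBasisFamily_of_eq_sum (eq_sum_ket hη hx hν hξ)

end Bases

/-! ### Raising, and its vanishing at the upper boundary -/

section TopBoundary

/-- The covector has eigenvalue function `c.eig (shiftUp a h)`, with a-th index 2s_a + 1. It is
nonzero at ξ_a^(k_a) for every admissible k, while D there kills |k⟩. So the covector is orthogonal
to the ket basis. -/
theorem bra_vecMul_C_top (hη : c.Generic) (hx : c.RootsLadder) (hν : c.RootNorm)
    (hξ : c.Inhomogeneous) {h : Fin N → ℕ} (hh : h ≤ c.twoS) {a : Fin N} (ha : h a = c.twoS a) :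
    c.bra h ᵥ* c.C (c.xi a (h a)) = 0 := by
  rw [eq_sum_bra hη hx hν hξ (c.bra h ᵥ* c.C (c.xi a (h a)))]
  refine Finset.sum_eq_zero fun k _ => ?_
  have h1 := dotProduct_mulVec (c.bra h ᵥ* c.C (c.xi a (h a))) (c.D (c.xi a (k.toNat a)))
    (c.ket k.toNat)
  rw [D_mulVec_ket hη hx, vecMul_C_vecMul_D hη hx (bra_vecMul_D hη hx h), eig_xi_self, zero_smul,
    dotProduct_zero, smul_dotProduct, eq_comm, smul_eq_zero] at h1
  have hk : k.toNat a ≤ c.twoS a := k.toNat_le a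
  rw [h1.resolve_left, mul_zero, zero_smul]
  refine eig_xi_ne_zero hη hξ hk (fun b hb => ?_) ?_
  · rw [shiftUp_of_ne hb]
    exact hh b
  · rw [shiftUp_self]
    omega

theorem B_mulVec_ket_top (hη : c.Generic) (hx : c.RootsLadder) (hν : c.RootNorm)
    (hξ : c.Inhomogeneous) {h : Fin N → ℕ} (hh : h ≤ c.twoS) {a : Fin N} (ha : h a = c.twoS a) :
    c.B (c.xi a (h a)) *ᵥ c.ket h = 0 := by
  rw [eq_sum_ket hη hx hν hξ (c.B (c.xi a (h a)) *ᵥ c.ket h)]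
  refine Finset.sum_eq_zero fun k _ => ?_
  have h1 := dotProduct_mulVec (c.bra k.toNat) (c.D (c.xi a (k.toNat a)))
    (c.B (c.xi a (h a)) *ᵥ c.ket h)
  rw [bra_vecMul_D hη hx, D_mulVec_B_mulVec hη hx (D_mulVec_ket hη hx h), eig_xi_self, zero_smul,
    zero_dotProduct, dotProduct_smul, smul_eq_zero] at h1
  have hk : k.toNat a ≤ c.twoS a := k.toNat_le a
  rw [h1.resolve_left, mul_zero, zero_smul]
  refine eig_xi_ne_zero hη hξ hk (fun b hb => ?_) ?_
  · rw [shiftUp_of_ne hb]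
    exact hh b
  · rw [shiftUp_self]
    omega

theorem bra_vecMul_C_xi (hη : c.Generic) (hx : c.RootsLadder) (hν : c.RootNorm)
    (hξ : c.Inhomogeneous) {h : Fin N → ℕ} (hh : h ≤ c.twoS) (a : Fin N) :
    c.bra h ᵥ* c.C (c.xi a (h a)) =
      ((if h a = c.twoS a then 0 else 1) * c.d (c.xi a (h a + 1))) • c.bra (shiftUp a h) := by
  split_ifs with ha
  · rw [bra_vecMul_C_top hη hx hν hξ hh ha, zero_mul, zero_smul]
  · rw [one_mul, bra_shiftUp hη hx, smul_inv_smul₀]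
    exact d_xi_ne_zero hη hξ (lt_of_le_of_ne (hh a) ha)

theorem B_xi_mulVec_ket (hη : c.Generic) (hx : c.RootsLadder) (hν : c.RootNorm)
    (hξ : c.Inhomogeneous) {h : Fin N → ℕ} (hh : h ≤ c.twoS) (a : Fin N) :
    c.B (c.xi a (h a)) *ᵥ c.ket h = -(c.a (c.xi a (h a)) • c.ket (shiftUp a h)) := by
  by_cases ha : h a = c.twoS a
  · rw [B_mulVec_ket_top hη hx hν hξ hh ha, ha, a_xi_twoS, zero_smul, neg_zero]
  · rw [ket_shiftUp hη hx, smul_neg, neg_neg, smul_inv_smul₀]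
    exact a_xi_ne_zero hη hξ (lt_of_le_of_ne (hh a) ha)

end TopBoundary

/-! ### Simplicity of the spectrum of `D` -/

section Spectrum

theorem ket_mem_jointEigenspace (hη : c.Generic) (hx : c.RootsLadder) (h : Fin N → ℕ) :
    c.ket h ∈ jointEigenspace c.D (c.eig h) := by
  rw [jointEigenspace, Submodule.mem_iInf]
  intro u
  rw [Module.End.mem_eigenspace_iff, Matrix.mulVecLin_apply, D_mulVec_ket hη hx]

theorem eq_eig_of_bra_dotProduct_ne_zero (hη : c.Generic) (hx : c.RootsLadder) {t : ℂ → ℂ}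
    {v : c.State} (hv : v ∈ jointEigenspace c.D t) {h : Fin N → ℕ} (hne : c.bra h ⬝ᵥ v ≠ 0) :
    t = c.eig h := by
  ext u
  rw [jointEigenspace, Submodule.mem_iInf] at hv
  have h1 := hv u
  rw [Module.End.mem_eigenspace_iff, Matrix.mulVecLin_apply] at h1
  have h2 := dotProduct_mulVec (c.bra h) (c.D u) v
  rw [h1, bra_vecMul_D hη hx, dotProduct_smul, smul_dotProduct] at h2
  exact mul_right_cancel₀ hne h2

theorem eig_toNat_injective (hη : c.Generic) (hξ : c.Inhomogeneous) {h k : c.Config}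
    (he : c.eig h.toNat = c.eig k.toNat) : h = k := by
  by_contra hne
  obtain ⟨a, ha⟩ := Function.ne_iff.1 (Config.toNat_injective.ne hne)
  refine eig_xi_ne_zero hη hξ (h.toNat_le a) (fun b _ => k.toNat_le b) ha ?_
  rw [← he, eig_xi_self]

theorem diagonalizableSimple_D (hη : c.Generic) (hx : c.RootsLadder) (hν : c.RootNorm)
    (hξ : c.Inhomogeneous) : DiagonalizableSimple c.D := by
  constructor
  · rw [← top_le_iff, ← (isBasisFamily_ket hη hx hν hξ).2, Submodule.span_le]
    rintro _ ⟨h, rfl⟩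
    exact Submodule.mem_iSup_of_mem _ (ket_mem_jointEigenspace hη hx h.toNat)
  · intro t
    -- In the ket expansion of a joint eigenvector only those k with `c.eig k` equal to t
    -- contribute, and there is at most one.
    by_cases ht : ∃ h : c.Config, t = c.eig h.toNat
    · obtain ⟨h, rfl⟩ := ht
      refine finrank_le_one ⟨c.ket h.toNat, ket_mem_jointEigenspace hη hx _⟩ fun w => ?_
      refine ⟨c.vdm h.toNat * (c.bra h.toNat ⬝ᵥ (w : c.State)), Subtype.ext ?_⟩
      rw [Submodule.coe_smul]
      conv_rhs => rw [eq_sum_ket hη hx hν hξ (w : c.State)]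
      rw [Finset.sum_eq_single h]
      · intro k _ hk
        rw [by_contra fun hne => hk (eig_toNat_injective hη hξ
          (eq_eig_of_bra_dotProduct_ne_zero hη hx w.2 hne)).symm, mul_zero, zero_smul]
      · simp
    · refine finrank_le_one 0 fun w => ⟨0, Subtype.ext ?_⟩
      rw [zero_smul, eq_sum_ket hη hx hν hξ (w : c.State)]
      refine (Finset.sum_eq_zero fun k _ => ?_).symm
      rw [by_contra fun hne => ht ⟨k, eq_eig_of_bra_dotProduct_ne_zero hη hx w.2 hne⟩, mul_zero,
        zero_smul]

end Spectrum

/-! ### Uniqueness of `A` -/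

section Uniqueness

/-- On each ket D becomes a product of sinh, which continuity cancels. With D on the left the same
is done on bras. -/
theorem eq_zero_of_mul_D_eq_zero (hη : c.Generic) (hx : c.RootsLadder) (hν : c.RootNorm)
    (hξ : c.Inhomogeneous) {X : ℂ → c.Op} (hX : Continuous X) (w : ℂ)
    (h : ∀ u, X u * c.D (u - w) = 0) : X = 0 := by
  have hket (k : c.Config) (u : ℂ) : X u *ᵥ c.ket k.toNat = 0 := by
    ext i
    refine congrFun (eq_zero_of_mul_prod_sinh_eq_zero Finset.univ
      (f := fun u => (X u *ᵥ c.ket k.toNat) i) ?_ (fun n => w + c.xi n (k.toNat n)) fun u => ?_) u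
    · exact (continuous_apply i).comp (hX.matrix_mulVec continuous_const)
    · have := congrFun (congrArg (fun M => M *ᵥ c.ket k.toNat) (h u)) i
      simp only [← mulVec_mulVec, D_mulVec_ket hη hx, mulVec_smul, zero_mulVec, Pi.smul_apply,
        smul_eq_mul, Pi.zero_apply, eig, sub_sub] at this
      rwa [mul_comm]
  ext u : 1
  rw [← mul_one (X u), one_eq_sum_vecMulVec hη hx hν hξ, Finset.mul_sum]
  refine Finset.sum_eq_zero fun k _ => ?_
  rw [mul_smul_comm, mul_vecMulVec, hket, zero_vecMulVec, smul_zero]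

theorem eq_zero_of_D_mul_eq_zero (hη : c.Generic) (hx : c.RootsLadder) (hν : c.RootNorm)
    (hξ : c.Inhomogeneous) {X : ℂ → c.Op} (hX : Continuous X)
    (h : ∀ u, c.D u * X u = 0) : X = 0 := by
  have hbra (k : c.Config) (u : ℂ) : c.bra k.toNat ᵥ* X u = 0 := by
    ext i
    refine congrFun (eq_zero_of_mul_prod_sinh_eq_zero Finset.univ
      (f := fun u => (c.bra k.toNat ᵥ* X u) i) ?_ (fun n => c.xi n (k.toNat n)) fun u => ?_) u
    · exact (continuous_apply i).comp (continuous_const.matrix_vecMul hX)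
    · have := congrFun (congrArg (fun M => c.bra k.toNat ᵥ* M) (h u)) i
      simp only [← vecMul_vecMul, bra_vecMul_D hη hx, smul_vecMul, vecMul_zero, Pi.smul_apply,
        smul_eq_mul, Pi.zero_apply, eig] at this
      rwa [mul_comm]
  ext u : 1
  rw [← one_mul (X u), one_eq_sum_vecMulVec hη hx hν hξ, Finset.sum_mul]
  refine Finset.sum_eq_zero fun k _ => ?_
  rw [smul_mul_assoc, vecMulVec_mul, hbra, vecMulVec_zero, smul_zero]

theorem continuous_A : Continuous c.A :=
  continuous_matrix fun i j => (c.isTrigPolyOp_monodromy.1 i j).continuous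

end Uniqueness

end XXZChain

theorem theorem3p1 {N : ℕ} (c : XXZChain N)
    (hη : c.Generic) (hx : c.RootsLadder) (hν : c.RootNorm) (hξ : c.Inhomogeneous) :
    -- the order of the factors in the definition of the states does not matter
    (∀ u v : ℂ, Commute (c.B u) (c.B v) ∧ Commute (c.C u) (c.C v)) ∧
    DiagonalizableSimple c.D ∧
    -- left representation
    (IsBasisFamily (fun h : c.Config => c.bra h.toNat) ∧
      ∀ (h : c.Config) (u : ℂ),
        Matrix.vecMul (c.bra h.toNat) (c.D u) = c.eig h.toNat u • c.bra h.toNat ∧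
        Matrix.vecMul (c.bra h.toNat) (c.C u) =
          ∑ a, (c.interp h.toNat a u * (if (h a : ℕ) = c.twoS a then 0 else 1) *
            c.d (c.xi a (h a + 1))) • c.bra (shiftUp a h.toNat) ∧
        Matrix.vecMul (c.bra h.toNat) (c.B u) =
          -∑ a, (c.interp h.toNat a u * (if (h a : ℕ) = 0 then 0 else 1) *
            c.a (c.xi a (h a - 1))) • c.bra (shiftDown a h.toNat)) ∧
    -- right representation
    (IsBasisFamily (fun h : c.Config => c.ket h.toNat) ∧
      ∀ (h : c.Config) (u : ℂ),
        Matrix.mulVec (c.D u) (c.ket h.toNat) = c.eig h.toNat u • c.ket h.toNat ∧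
        Matrix.mulVec (c.C u) (c.ket h.toNat) =
          ∑ a, (c.interp h.toNat a u * c.d (c.xi a (h a))) • c.ket (shiftDown a h.toNat) ∧
        Matrix.mulVec (c.B u) (c.ket h.toNat) =
          -∑ a, (c.interp h.toNat a u * c.a (c.xi a (h a))) • c.ket (shiftUp a h.toNat)) ∧
    -- `A` satisfies the quantum determinant relations, and each of them determines it
    ((∀ u : ℂ,
        c.A u * c.D (u - c.η) - c.B u * c.C (u - c.η) = (c.a u * c.d (u - c.η)) • (1 : c.Op) ∧
        c.D u * c.A (u - c.η) - c.C u * c.B (u - c.η) = (c.a u * c.d (u - c.η)) • (1 : c.Op)) ∧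
      ∀ A' : ℂ → c.Op, Continuous A' →
        ((∀ u : ℂ,
            A' u * c.D (u - c.η) - c.B u * c.C (u - c.η) =
              (c.a u * c.d (u - c.η)) • (1 : c.Op)) ∨
          (∀ u : ℂ,
            c.D u * A' (u - c.η) - c.C u * c.B (u - c.η) =
              (c.a u * c.d (u - c.η)) • (1 : c.Op))) →
        A' = c.A) ∧
    -- the pairing of left and right states
    (∀ h k : c.Config,
      c.bra h.toNat ⬝ᵥ c.ket k.toNat =
        (∏ j, if h j = k j then (1 : ℂ) else 0) *
          ∏ i, ∏ j ∈ Finset.Ioi i, 1 / Complex.sinh (c.xi j (h j) - c.xi i (h i))) ∧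
    -- the decomposition of the identity
    (1 : c.Op) =
      ∑ h : c.Config, c.vdm h.toNat • Matrix.vecMulVec (c.ket h.toNat) (c.bra h.toNat) := by
  open Matrix XXZChain in
  refine ⟨fun u v => ⟨B_commute hη hx u v, C_commute hη hx u v⟩, diagonalizableSimple_D hη hx hν hξ,
    ⟨isBasisFamily_bra hη hx hν hξ, fun h u => ⟨bra_vecMul_D hη hx _ u, ?_, ?_⟩⟩,
    ⟨isBasisFamily_ket hη hx hν hξ, fun h u => ⟨D_mulVec_ket hη hx _ u, ?_, ?_⟩⟩,
    ⟨fun u => ⟨qdet_A_D hη hx u, qdet_D_A hη hx u⟩, fun A' hA' hq => ?_⟩,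
    fun h k => ?_, one_eq_sum_vecMulVec hη hx hν hξ⟩
  · rw [vecMul_eq_interp hξ c.isTrigPolyOp_monodromy.2.2.1 _ h.toNat_le]
    refine Finset.sum_congr rfl fun a _ => ?_
    rw [bra_vecMul_C_xi hη hx hν hξ h.toNat_le, smul_smul, mul_assoc]
    rfl
  · rw [vecMul_eq_interp hξ c.isTrigPolyOp_monodromy.2.1 _ h.toNat_le, ← Finset.sum_neg_distrib]
    refine Finset.sum_congr rfl fun a _ => ?_
    rw [bra_vecMul_B_xi hη hx hξ h.toNat_le, smul_neg, smul_smul, mul_assoc]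
    rfl
  · rw [mulVec_eq_interp hξ c.isTrigPolyOp_monodromy.2.2.1 _ h.toNat_le]
    refine Finset.sum_congr rfl fun a _ => ?_
    rw [C_xi_mulVec_ket hη hx hξ h.toNat_le, smul_smul]
    rfl
  · rw [mulVec_eq_interp hξ c.isTrigPolyOp_monodromy.2.1 _ h.toNat_le, ← Finset.sum_neg_distrib]
    refine Finset.sum_congr rfl fun a _ => ?_
    rw [B_xi_mulVec_ket hη hx hν hξ h.toNat_le, smul_neg, smul_smul]
    rfl
  · have hc : Continuous fun u => A' u - c.A u := hA'.sub continuous_A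
    rcases hq with hq | hq
    · refine sub_eq_zero.1 (eq_zero_of_mul_D_eq_zero hη hx hν hξ hc c.η fun u => ?_)
      rw [Pi.sub_apply, sub_mul, sub_eq_zero]
      exact sub_left_injective ((hq u).trans (qdet_A_D hη hx u).symm)
    -- The second relation contains A' at u - η, so the shifted difference vanishes first and is
    -- then evaluated at u + η.
    · have h0 := eq_zero_of_D_mul_eq_zero hη hx hν hξ (X := fun u => A' (u - c.η) - c.A (u - c.η))
        (hc.comp (continuous_id.sub continuous_const)) fun u => by
          rw [mul_sub, sub_eq_zero]
          exact sub_left_injective ((hq u).trans (qdet_D_A hη hx u).symm)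
      ext u : 1
      have := congrFun h0 (u + c.η)
      simpa [sub_eq_zero] using this
  · rw [bra_dotProduct_ket hη hx hν hξ]
    split_ifs with hhk
    · subst hhk
      simp only [if_true, Finset.prod_const_one, one_mul, one_div, Finset.prod_inv_distrib]
      rfl
    · obtain ⟨a, ha⟩ := Function.ne_iff.1 hhk
      rw [Finset.prod_eq_zero (Finset.mem_univ a) (if_neg ha), zero_mul]
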